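/- Let $\mathbb{D}$ be the open unit disc, $dA=\frac{dx\,dy}{\pi}$, and let $1<p<\infty$, $p'=\frac{p}{p-1}$. A weight is a function $\omega:\mathbb{D}\to(0,\infty)$ integrable over $\mathbb{D}$ with respect to $dA$; it is radial if $\omega(z)=\omega(|z|)$ for all $z\in\mathbb{D}$. Let $\omega$ be a continuous radial weight, and put $\widehat\omega(r)=\int_r^1\omega(s)\,ds$ for $0\le r<1$. Assume that $\omega$ is regular, that is, there are constants $c,C>0$ such that $$c(1-r)\le \frac{\widehat\omega(r)}{\omega(r)}\le C(1-r),\qquad 0\le r<1,$$ and that $\omega$ satisfies the Muckenhoupt type condition $$\sup_{0\le r<1}\left(\int_r^1\widehat\omega(t)^{-p'/p}\,dt\right)^{p/p'}\int_0^r(1-t)^{-p}\,\widehat\omega(t)\,dt<\infty .$$ Let $A^p_\omega$ be the space of all analytic functions $f$ in $\mathbb{D}$ with $\|f\|_{A^p_\omega}^p=\int_{\mathbb{D}}|f(z)|^p\omega(z)\,dA(z)<\infty$. For $f\in A^p_\omega$ and $z\in\mathbb{D}$ let $$\mathcal{H}(f)(z)=\int_0^1 f(t)\,g'(tz)\,dt=\int_0^1\frac{f(t)}{1-tz}\,dt\quad\text{with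 } g(z)=\log\frac1{1-z},\qquad \widetilde{\mathcal{H}}(f)(z)=\int_0^1\frac{|f(t)|}{1-tz}\,dt$$ be the Hilbert operator and the sublinear Hilbert operator. Then these integrals converge absolutely for all $f\in A^p_\omega$ and $z\in\mathbb{D}$, and both $\mathcal{H}$ and $\widetilde{\mathcal{H}}$ are bounded on $A^p_\omega$: there is a constant $K=K(p,\omega)<\infty$ such that for every $f\in A^p_\omega$ the functions $\mathcal{H}(f)$ and $\widetilde{\mathcal{H}}(f)$ belong to $A^p_\omega$ and $$\|\mathcal{H}(f)\|_{A^p_\omega}\le K\|f\|_{A^p_\omega},\qquad \|\widetilde{\mathcal{H}}(f)\|_{A^p_\omega}\le K\|f\|_{A^p_\omega}.$$ -/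

import Mathlib

open MeasureTheory Set
open scoped ENNReal NNReal

namespace HilbertBergman

noncomputable section

/-- The open unit disc of the complex plane. -/
def disc : Set ℂ := Metric.ball 0 1

/-- Area measure on the plane, normalized so that the unit disc has measure one: `dx dy / π`. -/
def areaMeasure : Measure ℂ := ENNReal.ofReal (Real.pi⁻¹) • (volume : Measure ℂ)

/-- A weight: a positive function on the disc, integrable over the disc
(the values off the disc are irrelevant). -/
structure IsWeight (ω : ℂ → ℝ) : Prop where
  pos : ∀ z ∈ disc, 0 < ω z
  integrable : IntegrableOn ω disc areaMeasure

/-- A radial weight: `ω z = ω |z|` on the disc. -/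
structure IsRadialWeight (ω : ℂ → ℝ) : Prop extends IsWeight ω where
  radial : ∀ z ∈ disc, ω z = ω ((‖z‖ : ℝ) : ℂ)

/-- The tail integral `∫_r^1 ω(s) ds`. -/
def tail (ω : ℂ → ℝ) (r : ℝ) : ℝ := ∫ s in Ioo r 1, ω (s : ℂ)

/-- The distortion function `ψ_ω(r) = (1 / ω(r)) ∫_r^1 ω(s) ds`. -/
def distortion (ω : ℂ → ℝ) (r : ℝ) : ℝ := 1 / ω (r : ℂ) * tail ω r

/-- The class of regular weights: continuous radial weights whose distortion function is
comparable to `1 - r` on `[0, 1)`. -/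
structure IsRegular (ω : ℂ → ℝ) : Prop extends IsRadialWeight ω where
  continuousOn : ContinuousOn ω disc
  distortion_asymp : ∃ c C : ℝ, 0 < c ∧ 0 < C ∧ ∀ r ∈ Ico (0 : ℝ) 1,
    c * (1 - r) ≤ distortion ω r ∧ distortion ω r ≤ C * (1 - r)

/-- The class of radial weights with the Muckenhoupt type condition
`sup_{0 ≤ r < 1} (∫_r^1 (∫_t^1 ω)^{-p'/p} dt)^{p/p'} ∫_0^r (1-t)^{-p} (∫_t^1 ω) dt < ∞`,
where `p' = p / (p - 1)`. All outer integrals are taken in `[0, ∞]`. -/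
structure IsMuckenhoupt (p : ℝ) (ω : ℂ → ℝ) : Prop extends IsRadialWeight ω where
  sup_lt_top :
    (⨆ r ∈ Ico (0 : ℝ) 1,
      (∫⁻ t in Ioo r 1, ENNReal.ofReal (tail ω t ^ (-(p.conjExponent / p)))) ^
          (p / p.conjExponent) *
        ∫⁻ t in Ioo 0 r, ENNReal.ofReal ((1 - t) ^ (-p) * tail ω t)) < ∞

/-- The Bergman norm `(∫_𝔻 |f|^p ω dA)^{1/p}`, with values in `[0, ∞]`. -/
def bergmanNorm (p : ℝ) (ω : ℂ → ℝ) (f : ℂ → ℂ) : ℝ≥0∞ :=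
  (∫⁻ z in disc, ‖f z‖ₑ ^ p * ENNReal.ofReal (ω z) ∂areaMeasure) ^ (1 / p)

/-- Membership in the weighted Bergman space: analytic in the disc, with finite norm. -/
structure MemBergman (p : ℝ) (ω : ℂ → ℝ) (f : ℂ → ℂ) : Prop where
  analytic : AnalyticOnNhd ℂ f disc
  norm_lt_top : bergmanNorm p ω f < ∞

/-- The integrand of the generalized Hilbert operator with symbol `g`. -/
def genHilbertIntegrand (g f : ℂ → ℂ) (z : ℂ) (t : ℝ) : ℂ := f t * deriv g (t * z)

/-- The generalized Hilbert operator `H_g(f)(z) = ∫_0^1 f(t) g'(tz) dt`. -/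
def genHilbert (g f : ℂ → ℂ) (z : ℂ) : ℂ := ∫ t in Ioo (0 : ℝ) 1, genHilbertIntegrand g f z t

/-- The symbol `log (1 / (1 - z))` of the classical Hilbert operator. -/
def logSymbol (z : ℂ) : ℂ := Complex.log (1 / (1 - z))

/-- The (classical) Hilbert operator. -/
def hilbert (f : ℂ → ℂ) : ℂ → ℂ := genHilbert logSymbol f

/-- The integrand of the sublinear Hilbert operator. -/
def subHilbertIntegrand (f : ℂ → ℂ) (z : ℂ) (t : ℝ) : ℂ := ((‖f t‖ : ℝ) : ℂ) / (1 - t * z)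

/-- The sublinear Hilbert operator `∫_0^1 |f(t)| / (1 - tz) dt`. -/
def subHilbert (f : ℂ → ℂ) (z : ℂ) : ℂ := ∫ t in Ioo (0 : ℝ) 1, subHilbertIntegrand f z t

/-- `T` maps the weighted Bergman space into itself, boundedly. -/
def IsBoundedOnBergman (p : ℝ) (ω : ℂ → ℝ) (T : (ℂ → ℂ) → ℂ → ℂ) : Prop :=
  ∃ C : ℝ≥0, ∀ f : ℂ → ℂ, MemBergman p ω f →
    MemBergman p ω (T f) ∧ bergmanNorm p ω (T f) ≤ C * bergmanNorm p ω f

end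

end HilbertBergman

/-! On the disc both operators have the form `cauchyTransform ψ`, with `|ψ| = |f|` on the radius
`(0,1)`, so only the size of `f` there matters. Since `1 - t + |1 - z| ≤ 3 |1 - tz|`, the transform
is at most three times the Stieltjes transform of `|f|` evaluated at the distance `|1 - z|`.
Boundedness then follows by chaining three estimates.

From disc to radius (`IsRegular.exists_lintegral_disc_le`): a nonincreasing function of `|1 - z|`,
integrated against `ω dA`, is controlled by a radial integral against the tail of `ω`, because `|1 -
re^{iθ}|` is at least the maximum of `1 - r` and `|θ|/π`.

On the radius (`exists_stieltjes_le`): the kernel `1/((1-t)+(1-r))` is at most `1/(1-r)` for `t > r`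
and `1/(1-t)` for `t < r`. The first piece is a Hardy operator, bounded on `L^p` of the tail by the
Muckenhoupt condition (`muckenhoupt_hardy`); the second needs only that the tail is nonincreasing
(`adjoint_hardy`). Both are Schur tests.

From radius back to disc (`IsRegular.exists_lintegral_radius_le`): the sub-mean value property of
`|f|^p` on discs of radius `(1-t)/2`, where a regular weight is comparable to its tail divided by `1
- t`, bounds the `L^p` norm of `f` on the radius by its Bergman norm.

Finiteness of the Stieltjes norm also gives `f ∈ L¹(0,1)`, hence absolute convergence and
analyticity. -/

namespace HilbertBergman

/-! ### Integral inequalities: primitives, weighted Hölder, Schur test -/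

/-- A nonnegative derivative integrates to at most the supremum of a nonnegative primitive. -/
lemma lintegral_deriv_le {H h : ℝ → ℝ} {a b M : ℝ}
    (hd : ∀ x ∈ Ioo a b, HasDerivAt H (h x) x) (h0 : ∀ x ∈ Ioo a b, 0 ≤ h x)
    (hH : ∀ x ∈ Ioo a b, 0 ≤ H x) (hM : ∀ x ∈ Ioo a b, H x ≤ M) :
    ∫⁻ x in Ioo a b, ENNReal.ofReal (h x) ≤ ENNReal.ofReal M := by
  rcases le_or_gt b a with hab | hab
  · simp [Ioo_eq_empty_of_le hab]
  -- Nothing is known at the endpoints, and integrability of `h` is not assumed. On compact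
  -- subintervals nonnegativity supplies integrability, and the integral is a difference of values
  -- of `H`, at most `M`.
  obtain ⟨u, -, hu, hua⟩ := exists_seq_strictAnti_tendsto' hab
  obtain ⟨v, -, hv, hvb⟩ := exists_seq_strictMono_tendsto' hab
  have hmeas : AEMeasurable (fun x => ENNReal.ofReal (h x)) (volume.restrict (Ioo a b)) := by
    refine AEMeasurable.ennreal_ofReal ⟨deriv H, measurable_deriv H, ?_⟩
    filter_upwards [ae_restrict_mem measurableSet_Ioo] with x hx
    exact (hd x hx).deriv.symm
  have hcov : AECover (volume.restrict (Ioo a b)) Filter.atTop fun n => Icc (u n) (v n) :=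
    aecover_Ioo_of_Icc hua hvb
  refine le_of_tendsto' (hcov.lintegral_tendsto_of_countably_generated hmeas) fun n => ?_
  have hsub : Icc (u n) (v n) ⊆ Ioo a b := Icc_subset_Ioo (hu n).1 (hv n).2
  rw [Measure.restrict_restrict measurableSet_Icc, inter_eq_left.2 hsub]
  rcases le_or_gt (u n) (v n) with huv | huv
  swap
  · simp [huv]
  have hc : ContinuousOn H (uIcc (u n) (v n)) := by
    rw [uIcc_of_le huv]
    exact fun x hx => (hd x (hsub hx)).continuousAt.continuousWithinAt
  have hint : IntervalIntegrable h volume (u n) (v n) := by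
    refine intervalIntegral.intervalIntegrable_deriv_of_nonneg hc (fun x hx => hd x ?_)
      (fun x hx => h0 x ?_) <;>
    · rw [min_eq_left huv, max_eq_right huv] at hx
      exact hsub (Ioo_subset_Icc_self hx)
  have hftc := intervalIntegral.integral_eq_sub_of_hasDerivAt
    (fun x hx => hd x (hsub (by rwa [uIcc_of_le huv] at hx))) hint
  rw [intervalIntegrable_iff_integrableOn_Icc_of_le huv] at hint
  rw [intervalIntegral.integral_of_le huv, ← integral_Icc_eq_integral_Ioc] at hftc
  rw [← ofReal_integral_eq_lintegral_ofReal hint, hftc]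
  · refine ENNReal.ofReal_le_ofReal ?_
    have := hH _ (hsub (left_mem_Icc.2 huv))
    have := hM _ (hsub (right_mem_Icc.2 huv))
    linarith
  · filter_upwards [ae_restrict_mem measurableSet_Icc] with x hx using h0 x (hsub hx)

/-- Hölder's inequality with an auxiliary weight. -/
lemma lintegral_mul_rpow_le {α : Type*} [MeasurableSpace α] {μ : Measure α} {p : ℝ} (hp : 1 < p)
    {k φ a : α → ℝ≥0∞} (hk : AEMeasurable k μ) (hφ : AEMeasurable φ μ) (ha : AEMeasurable a μ)
    (ha0 : ∀ᵐ t ∂μ, a t ≠ 0) (hat : ∀ᵐ t ∂μ, a t ≠ ∞) :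
    (∫⁻ t, k t * φ t ∂μ) ^ p ≤
      (∫⁻ t, k t * (φ t ^ p * a t ^ (1 - p)) ∂μ) * (∫⁻ t, k t * a t ∂μ) ^ (p - 1) := by
  have hp0 : 0 < p := by linarith
  have hpq : p.HolderConjugate (p / (p - 1)) := Real.HolderConjugate.conjExponent hp
  have hq0 : 0 < p / (p - 1) := hpq.symm.pos
  set q := p / (p - 1) with hq
  have hpp : 1 / p + 1 / q = 1 := by simpa using hpq.inv_add_inv_eq_one
  -- Hölder for `kφ = (k^{1/p} φ a^{-1/q}) (k^{1/q} a^{1/q})`; the powers of `a` cancel because `a`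
  -- is almost everywhere neither `0` nor `∞`.
  have key := ENNReal.lintegral_mul_le_Lp_mul_Lq μ hpq
    (f := fun t => k t ^ (1 / p) * (φ t * a t ^ (-(1 / q)))) (g := fun t => k t ^ (1 / q) * a t ^ (1 / q))
    (by fun_prop) (by fun_prop)
  have h1 : ∫⁻ t, k t * φ t ∂μ = ∫⁻ t, ((fun t => k t ^ (1 / p) * (φ t * a t ^ (-(1 / q)))) *
      (fun t => k t ^ (1 / q) * a t ^ (1 / q))) t ∂μ := by
    refine lintegral_congr_ae ?_
    filter_upwards [ha0, hat] with t h0 ht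
    have e1 : k t = k t ^ (1 / p) * k t ^ (1 / q) := by
      rw [← ENNReal.rpow_add_of_nonneg _ _ (by positivity) (by positivity), hpp, ENNReal.rpow_one]
    have e2 : a t ^ (-(1 / q)) * a t ^ (1 / q) = 1 := by
      rw [← ENNReal.rpow_add _ _ h0 ht]; simp
    calc k t * φ t = (k t ^ (1 / p) * k t ^ (1 / q)) * φ t * 1 := by rw [← e1, mul_one]
      _ = _ := by rw [← e2]; simp only [Pi.mul_apply]; ring
  have h2 : ∫⁻ t, (k t ^ (1 / p) * (φ t * a t ^ (-(1 / q)))) ^ p ∂μ =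
      ∫⁻ t, k t * (φ t ^ p * a t ^ (1 - p)) ∂μ := by
    refine lintegral_congr fun t => ?_
    rw [ENNReal.mul_rpow_of_nonneg _ _ hp0.le, ENNReal.mul_rpow_of_nonneg _ _ hp0.le,
      ← ENNReal.rpow_mul, ← ENNReal.rpow_mul, one_div_mul_cancel hp0.ne', ENNReal.rpow_one]
    congr 3
    rw [hq]; field_simp; ring
  have h3 : ∫⁻ t, (k t ^ (1 / q) * a t ^ (1 / q)) ^ q ∂μ = ∫⁻ t, k t * a t ∂μ := by
    refine lintegral_congr fun t => ?_
    rw [ENNReal.mul_rpow_of_nonneg _ _ hq0.le,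
      ← ENNReal.rpow_mul, ← ENNReal.rpow_mul, one_div_mul_cancel hq0.ne', ENNReal.rpow_one,
      ENNReal.rpow_one]
  rw [← h1, h2, h3] at key
  calc _ ≤ _ := ENNReal.rpow_le_rpow key hp0.le
    _ = _ := by
      rw [ENNReal.mul_rpow_of_nonneg _ _ hp0.le, ← ENNReal.rpow_mul, ← ENNReal.rpow_mul,
        one_div_mul_cancel hp0.ne', ENNReal.rpow_one]
      congr 2
      rw [hq]; field_simp

/-- The weighted Schur test. -/
lemma schur_test {μ ν : Measure ℝ} [SFinite μ] [SFinite ν] {p : ℝ} (hp : 1 < p)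
    {k : ℝ → ℝ → ℝ≥0∞} {φ a b v w : ℝ → ℝ≥0∞} {C : ℝ≥0∞}
    (hk : Measurable (Function.uncurry k)) (hφ : AEMeasurable φ μ) (ha : AEMeasurable a μ)
    (hb : AEMeasurable b ν) (hw : AEMeasurable w ν) (hv : AEMeasurable v μ)
    (ha0 : ∀ᵐ t ∂μ, a t ≠ 0) (hat : ∀ᵐ t ∂μ, a t ≠ ∞)
    (h1 : ∀ᵐ r ∂ν, ∫⁻ t, k r t * a t ∂μ ≤ b r)
    (h2 : ∀ᵐ t ∂μ, ∫⁻ r, w r * k r t * b r ^ (p - 1) ∂ν ≤ C * (a t ^ (p - 1) * v t)) :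
    ∫⁻ r, w r * (∫⁻ t, k r t * φ t ∂μ) ^ p ∂ν ≤ C * ∫⁻ t, φ t ^ p * v t ∂μ := by
  have hp1 : 0 < p - 1 := by linarith
  have hk1 : ∀ r, Measurable (k r) := fun r => hk.comp measurable_prodMk_left
  have hk2 : ∀ t, Measurable fun r => k r t := fun t => hk.comp measurable_prodMk_right
  have hψ : AEMeasurable (fun t => φ t ^ p * a t ^ (1 - p)) μ := by fun_prop
  have hβ : AEMeasurable (fun r => w r * b r ^ (p - 1)) ν := by fun_prop
  -- Hölder with weight `a` and `h1` leave a factor `b r ^ (p - 1)`; after Tonelli the inner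
  -- integral over `r` is the one in `h2`.
  calc ∫⁻ r, w r * (∫⁻ t, k r t * φ t ∂μ) ^ p ∂ν
      ≤ ∫⁻ r, ∫⁻ t, (w r * b r ^ (p - 1)) * (k r t * (φ t ^ p * a t ^ (1 - p))) ∂μ ∂ν := by
        refine lintegral_mono_ae ?_
        filter_upwards [h1] with r hr
        have hm : AEMeasurable (fun t => k r t * (φ t ^ p * a t ^ (1 - p))) μ :=
          (hk1 r).aemeasurable.mul hψ
        rw [lintegral_const_mul'' _ hm, mul_assoc]
        gcongr
        refine (lintegral_mul_rpow_le hp (hk1 r).aemeasurable hφ ha ha0 hat).trans ?_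
        rw [mul_comm]
        gcongr
    _ = ∫⁻ t, ∫⁻ r, (w r * b r ^ (p - 1)) * (k r t * (φ t ^ p * a t ^ (1 - p))) ∂ν ∂μ := by
        refine lintegral_lintegral_swap ?_
        have e1 : AEMeasurable (fun z : ℝ × ℝ => w z.1 * b z.1 ^ (p - 1)) (ν.prod μ) :=
          hβ.comp_fst
        have e2 : AEMeasurable (fun z : ℝ × ℝ => φ z.2 ^ p * a z.2 ^ (1 - p)) (ν.prod μ) :=
          hψ.comp_snd
        exact e1.mul (hk.aemeasurable.mul e2)
    _ ≤ ∫⁻ t, C * (φ t ^ p * v t) ∂μ := by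
        refine lintegral_mono_ae ?_
        filter_upwards [h2, ha0, hat] with t ht h0 h0'
        calc ∫⁻ r, (w r * b r ^ (p - 1)) * (k r t * (φ t ^ p * a t ^ (1 - p))) ∂ν
            = ∫⁻ r, (w r * k r t * b r ^ (p - 1)) * (φ t ^ p * a t ^ (1 - p)) ∂ν := by
              refine lintegral_congr fun r => by ring
          _ = (∫⁻ r, w r * k r t * b r ^ (p - 1) ∂ν) * (φ t ^ p * a t ^ (1 - p)) := by
              refine lintegral_mul_const'' _ ?_
              exact (hw.mul (hk2 t).aemeasurable).mul (hb.pow_const _)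
          _ ≤ (C * (a t ^ (p - 1) * v t)) * (φ t ^ p * a t ^ (1 - p)) := by gcongr
          _ = C * (φ t ^ p * v t) * (a t ^ (p - 1) * a t ^ (1 - p)) := by ring
          _ = C * (φ t ^ p * v t) := by
              rw [← ENNReal.rpow_add _ _ h0 h0']; simp
    _ = C * ∫⁻ t, φ t ^ p * v t ∂μ := lintegral_const_mul'' _ (by fun_prop)

/-! ### Primitives and truncated kernels on the radius -/

/-- The tail integral is a primitive of minus the integrand. -/
lemma hasDerivAt_integral_Ioo_right {g : ℝ → ℝ} {a r : ℝ} (hr : r ∈ Ioo a 1)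
    (hg : ContinuousOn g (Ioo a 1)) (hint : IntegrableOn g (Ioo r 1)) :
    HasDerivAt (fun x => ∫ t in Ioo x 1, g t) (-g r) r := by
  have hmem : Ioo a 1 ∈ nhds r := Ioo_mem_nhds hr.1 hr.2
  have hi : IntervalIntegrable g volume r 1 := by
    rwa [intervalIntegrable_iff_integrableOn_Ioo_of_le hr.2.le]
  have hsm : StronglyMeasurableAtFilter g (nhds r) volume :=
    hg.stronglyMeasurableAtFilter isOpen_Ioo r hr
  refine (intervalIntegral.integral_hasDerivAt_left hi hsm
    (hg.continuousAt hmem)).congr_of_eventuallyEq ?_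
  filter_upwards [hmem] with x hx
  rw [intervalIntegral.integral_of_le hx.2.le, integral_Ioc_eq_integral_Ioo]

lemma hasDerivAt_integral_Ioo_left {g : ℝ → ℝ} {a r : ℝ} (hr : r ∈ Ioo 0 a)
    (hg : ContinuousOn g (Ioo 0 a)) (hint : IntegrableOn g (Ioo 0 r)) :
    HasDerivAt (fun x => ∫ t in Ioo 0 x, g t) (g r) r := by
  have hmem : Ioo 0 a ∈ nhds r := Ioo_mem_nhds hr.1 hr.2
  have hi : IntervalIntegrable g volume 0 r := by
    rwa [intervalIntegrable_iff_integrableOn_Ioo_of_le hr.1.le]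
  have hsm : StronglyMeasurableAtFilter g (nhds r) volume :=
    hg.stronglyMeasurableAtFilter isOpen_Ioo r hr
  refine (intervalIntegral.integral_hasDerivAt_right hi hsm
    (hg.continuousAt hmem)).congr_of_eventuallyEq ?_
  filter_upwards [hmem] with x hx
  rw [intervalIntegral.integral_of_le hx.1.le, integral_Ioc_eq_integral_Ioo]

lemma setLIntegral_ite_lt {r : ℝ} (hr : r ∈ Ioo (0 : ℝ) 1) (f : ℝ → ℝ≥0∞) :
    ∫⁻ t in Ioo (0 : ℝ) 1, (if t < r then f t else 0) = ∫⁻ t in Ioo 0 r, f t := by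
  have : (fun t => if t < r then f t else 0) = (Iio r).indicator f := by
    ext t; simp [indicator]
  rw [this, lintegral_indicator measurableSet_Iio, Measure.restrict_restrict measurableSet_Iio]
  congr 2
  ext t; simp only [mem_inter_iff, mem_Iio, mem_Ioo]
  exact ⟨fun h => ⟨h.2.1, h.1⟩, fun h => ⟨h.2, h.1, h.2.trans hr.2⟩⟩

lemma setLIntegral_ite_gt {r : ℝ} (hr : r ∈ Ioo (0 : ℝ) 1) (f : ℝ → ℝ≥0∞) :
    ∫⁻ t in Ioo (0 : ℝ) 1, (if r < t then f t else 0) = ∫⁻ t in Ioo r 1, f t := by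
  have : (fun t => if r < t then f t else 0) = (Ioi r).indicator f := by
    ext t; simp [indicator]
  rw [this, lintegral_indicator measurableSet_Ioi, Measure.restrict_restrict measurableSet_Ioi]
  congr 2
  ext t; simp only [mem_inter_iff, mem_Ioi, mem_Ioo]
  exact ⟨fun h => ⟨h.1, h.2.2⟩, fun h => ⟨h.1, hr.1.trans h.1, h.2⟩⟩

lemma hasDerivAt_one_sub_rpow {x : ℝ} (hx : x < 1) (γ : ℝ) :
    HasDerivAt (fun t : ℝ => (1 - t) ^ γ) (-(γ * (1 - x) ^ (γ - 1))) x := by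
  have h := ((hasDerivAt_id x).const_sub 1).rpow_const (p := γ) (Or.inl (by simp; linarith))
  simpa using h

/-! ### The two weighted Hardy inequalities -/

/-- The adjoint Hardy operator `φ ↦ ∫_0^r φ(t) / (1 - t) dt` is bounded on `L^p(T)` when `T` is
nonincreasing. -/
lemma adjoint_hardy {p : ℝ} (hp : 1 < p) {T : ℝ → ℝ} (hT : AntitoneOn T (Ioo 0 1))
    (hTc : ContinuousOn T (Ioo 0 1)) :
    ∃ C : ℝ, ∀ φ : ℝ → ℝ≥0∞, AEMeasurable φ (volume.restrict (Ioo 0 1)) →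
      ∫⁻ r in Ioo (0 : ℝ) 1, ENNReal.ofReal (T r) *
        (∫⁻ t in Ioo (0 : ℝ) 1, (if t < r then ENNReal.ofReal (1 - t)⁻¹ else 0) * φ t) ^ p ≤
      ENNReal.ofReal C * ∫⁻ t in Ioo (0 : ℝ) 1, φ t ^ p * ENNReal.ofReal (T t) := by
  have hp1 : 0 < p - 1 := by linarith
  -- The test function is `(1-t)^{-β}`. The first Schur condition needs `β > 0`, the second `β(p-1)
  -- < 1`; the choice `β(p-1) = 1/2` meets both.
  obtain ⟨β, hβ⟩ : ∃ β, β = 1 / (2 * (p - 1)) := ⟨_, rfl⟩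
  have hβ0 : 0 < β := by rw [hβ]; positivity
  have hβp : β * (p - 1) = 1 / 2 := by rw [hβ]; field_simp
  have hTm : AEMeasurable (fun r => ENNReal.ofReal (T r)) (volume.restrict (Ioo 0 1)) :=
    (hTc.aemeasurable measurableSet_Ioo).ennreal_ofReal
  refine ⟨2 * β⁻¹ ^ (p - 1), fun φ hφ => ?_⟩
  refine schur_test hp (k := fun r t => if t < r then ENNReal.ofReal (1 - t)⁻¹ else 0)
    (a := fun t => ENNReal.ofReal ((1 - t) ^ (-β)))
    (b := fun r => ENNReal.ofReal (β⁻¹ * (1 - r) ^ (-β)))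
    ?_ hφ (by fun_prop) (by fun_prop) hTm hTm ?_ ?_ ?_ ?_
  · exact Measurable.ite (measurableSet_lt measurable_snd measurable_fst) (by fun_prop)
      measurable_const
  · filter_upwards [ae_restrict_mem measurableSet_Ioo] with t ht
    have : 0 < 1 - t := by linarith [ht.2]
    simp only [ne_eq, ENNReal.ofReal_eq_zero, not_le]; positivity
  · exact Filter.Eventually.of_forall fun t => ENNReal.ofReal_ne_top
  · filter_upwards [ae_restrict_mem measurableSet_Ioo] with r hr
    simp only [ite_mul, zero_mul]
    rw [setLIntegral_ite_lt hr]
    refine le_of_eq_of_le (setLIntegral_congr_fun measurableSet_Ioo fun t ht => ?_)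
      (lintegral_deriv_le (H := fun t => β⁻¹ * (1 - t) ^ (-β))
        (h := fun t => (1 - t) ^ (-β - 1)) (a := 0) (b := r) ?_ ?_ ?_ ?_)
    · have : 0 < 1 - t := by linarith [ht.2, hr.2]
      rw [← ENNReal.ofReal_mul (by positivity), ← Real.rpow_neg_one, ← Real.rpow_add this]
      congr 2; ring
    · intro x hx
      refine ((hasDerivAt_one_sub_rpow (hx.2.trans hr.2) (-β)).const_mul β⁻¹).congr_deriv ?_
      field_simp
    · intro x hx
      have : 0 < 1 - x := by linarith [hx.2, hr.2]
      positivity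
    · intro x hx
      have : 0 < 1 - x := by linarith [hx.2, hr.2]
      positivity
    · intro x hx
      have h1 : 0 < 1 - r := by linarith [hr.2]
      gcongr ?_ * ?_
      exact Real.rpow_le_rpow_of_nonpos h1 (by linarith [hx.2]) (by linarith)
  · filter_upwards [ae_restrict_mem measurableSet_Ioo] with t ht
    have h1t : 0 < 1 - t := by linarith [ht.2]
    simp only [mul_ite, ite_mul, mul_zero, zero_mul]
    rw [setLIntegral_ite_gt ht]
    -- Monotonicity replaces `T r` by `T t`. What remains is `∫_t^1 (1-r)^{-1/2} dr = 2(1-t)^{1/2}`,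
    -- and dividing by `1 - t` gives twice `a(t)^{p-1}`.
    calc ∫⁻ r in Ioo t 1, ENNReal.ofReal (T r) * ENNReal.ofReal (1 - t)⁻¹ *
          ENNReal.ofReal (β⁻¹ * (1 - r) ^ (-β)) ^ (p - 1)
        ≤ ∫⁻ r in Ioo t 1, (ENNReal.ofReal (T t) * ENNReal.ofReal (1 - t)⁻¹ *
          ENNReal.ofReal (β⁻¹ ^ (p - 1))) * ENNReal.ofReal ((1 - r) ^ (-(1 / 2) : ℝ)) := by
          refine setLIntegral_mono' measurableSet_Ioo fun r hr => ?_
          have h1r : 0 < 1 - r := by linarith [hr.2]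
          rw [mul_assoc (_ * _)]
          gcongr ?_ * _ * ?_
          · exact ENNReal.ofReal_le_ofReal (hT ht ⟨ht.1.trans hr.1, hr.2⟩ hr.1.le)
          · rw [ENNReal.ofReal_rpow_of_nonneg (by positivity) hp1.le,
              ← ENNReal.ofReal_mul (by positivity),
              Real.mul_rpow (by positivity) (by positivity), ← Real.rpow_mul h1r.le,
              neg_mul, hβp]
      _ = (ENNReal.ofReal (T t) * ENNReal.ofReal (1 - t)⁻¹ *
          ENNReal.ofReal (β⁻¹ ^ (p - 1))) *
            ∫⁻ r in Ioo t 1, ENNReal.ofReal ((1 - r) ^ (-(1 / 2) : ℝ)) :=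
          lintegral_const_mul _ (by fun_prop)
      _ ≤ (ENNReal.ofReal (T t) * ENNReal.ofReal (1 - t)⁻¹ *
          ENNReal.ofReal (β⁻¹ ^ (p - 1))) * ENNReal.ofReal (2 * (1 - t) ^ (1 / 2 : ℝ)) := by
          gcongr
          refine lintegral_deriv_le
            (H := fun r => 2 * (1 - t) ^ (1 / 2 : ℝ) - 2 * (1 - r) ^ (1 / 2 : ℝ)) ?_ ?_ ?_ ?_
          · intro x hx
            refine (((hasDerivAt_one_sub_rpow hx.2 (1 / 2)).const_mul 2).const_sub _).congr_deriv ?_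
            norm_num
            ring
          · intro x hx
            have : 0 < 1 - x := by linarith [hx.2]
            positivity
          · intro x hx
            have : 0 < 1 - x := by linarith [hx.2]
            have := Real.rpow_le_rpow this.le (by linarith [hx.1] : 1 - x ≤ 1 - t)
              (by norm_num : (0 : ℝ) ≤ 1 / 2)
            linarith
          · intro x hx
            have : 0 < 1 - x := by linarith [hx.2]
            have : 0 ≤ (1 - x) ^ (1 / 2 : ℝ) := by positivity
            linarith
      _ = _ := by
          rw [ENNReal.ofReal_rpow_of_nonneg (by positivity) hp1.le, ← Real.rpow_mul h1t.le,
            neg_mul, hβp, mul_assoc, mul_assoc, mul_comm (ENNReal.ofReal (T t)), ← mul_assoc,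
            ← mul_assoc]
          congr 1
          rw [← ENNReal.ofReal_mul (by positivity), ← ENNReal.ofReal_mul (by positivity),
            ← ENNReal.ofReal_mul (by positivity)]
          congr 1
          have : (1 - t)⁻¹ * (1 - t) ^ (1 / 2 : ℝ) = (1 - t) ^ (-(1 / 2) : ℝ) := by
            rw [← Real.rpow_neg_one, ← Real.rpow_add h1t]; norm_num
          rw [← this]; ring

/-- Muckenhoupt's weighted Hardy inequality. -/
lemma muckenhoupt_hardy {p : ℝ} (hp : 1 < p) {T : ℝ → ℝ} (hT0 : ∀ t ∈ Ioo (0 : ℝ) 1, 0 < T t)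
    (hTc : ContinuousOn T (Ioo 0 1)) {B : ℝ}
    (hσ : ∀ r ∈ Ioo (0 : ℝ) 1, IntegrableOn (fun t => T t ^ (-(1 / (p - 1)))) (Ioo r 1))
    (hw : ∀ r ∈ Ioo (0 : ℝ) 1, IntegrableOn (fun t => (1 - t) ^ (-p) * T t) (Ioo 0 r))
    (hB : ∀ r ∈ Ioo (0 : ℝ) 1, (∫ t in Ioo r 1, T t ^ (-(1 / (p - 1)))) ^ (p - 1) *
      ∫ t in Ioo 0 r, (1 - t) ^ (-p) * T t ≤ B) :
    ∃ C : ℝ, ∀ φ : ℝ → ℝ≥0∞, AEMeasurable φ (volume.restrict (Ioo 0 1)) →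
      ∫⁻ r in Ioo (0 : ℝ) 1, ENNReal.ofReal ((1 - r) ^ (-p) * T r) *
        (∫⁻ t in Ioo (0 : ℝ) 1, (if r < t then 1 else 0) * φ t) ^ p ≤
      ENNReal.ofReal C * ∫⁻ t in Ioo (0 : ℝ) 1, φ t ^ p * ENNReal.ofReal (T t) := by
  have hp0 : 0 < p := by linarith
  have hp1 : 0 < p - 1 := by linarith
  obtain ⟨q, hq⟩ : ∃ q, q = p / (p - 1) := ⟨_, rfl⟩
  have hq0 : 0 < q := by rw [hq]; positivity
  have hqi : q⁻¹ = 1 - 1 / p := by rw [hq]; field_simp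
  obtain ⟨σ, hσd⟩ : ∃ σ : ℝ → ℝ, σ = fun t => T t ^ (-(1 / (p - 1))) := ⟨_, rfl⟩
  obtain ⟨w, hwd⟩ : ∃ w : ℝ → ℝ, w = fun t => (1 - t) ^ (-p) * T t := ⟨_, rfl⟩
  obtain ⟨S, hS⟩ : ∃ S : ℝ → ℝ, S = fun r => ∫ t in Ioo r 1, σ t := ⟨_, rfl⟩
  obtain ⟨W, hW⟩ : ∃ W : ℝ → ℝ, W = fun r => ∫ t in Ioo 0 r, w t := ⟨_, rfl⟩
  have hσ0 : ∀ t ∈ Ioo (0 : ℝ) 1, 0 < σ t := fun t ht => by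
    have := hT0 t ht
    rw [hσd]; positivity
  have hw0 : ∀ t ∈ Ioo (0 : ℝ) 1, 0 < w t := fun t ht => by
    have := hT0 t ht
    have : 0 < 1 - t := by linarith [ht.2]
    rw [hwd]; positivity
  have hσc : ContinuousOn σ (Ioo 0 1) := by
    rw [hσd]
    exact hTc.rpow_const fun t ht => Or.inl (hT0 t ht).ne'
  have hwc : ContinuousOn w (Ioo 0 1) := by
    rw [hwd]
    refine ContinuousOn.mul (ContinuousOn.rpow_const (by fun_prop) fun t ht => Or.inl ?_) hTc
    exact (sub_pos.2 ht.2).ne'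
  replace hσ : ∀ r ∈ Ioo (0 : ℝ) 1, IntegrableOn σ (Ioo r 1) := by rw [hσd]; exact hσ
  replace hw : ∀ r ∈ Ioo (0 : ℝ) 1, IntegrableOn w (Ioo 0 r) := by rw [hwd]; exact hw
  replace hB : ∀ r ∈ Ioo (0 : ℝ) 1, S r ^ (p - 1) * W r ≤ B := by
    rw [hS, hW, hσd, hwd]; exact hB
  have hSd : ∀ r ∈ Ioo (0 : ℝ) 1, HasDerivAt S (-σ r) r := fun r hr => by
    rw [hS]; exact hasDerivAt_integral_Ioo_right hr hσc (hσ r hr)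
  have hWd : ∀ r ∈ Ioo (0 : ℝ) 1, HasDerivAt W (w r) r := fun r hr => by
    rw [hW]; exact hasDerivAt_integral_Ioo_left hr hwc (hw r hr)
  have hS0 : ∀ r ∈ Ioo (0 : ℝ) 1, 0 < S r := fun r hr => by
    rw [hS]
    have hsub : Ioo r 1 ⊆ Ioo 0 1 := Ioo_subset_Ioo_left hr.1.le
    refine (setIntegral_pos_iff_support_of_nonneg_ae ?_ (hσ r hr)).2 ?_
    · filter_upwards [ae_restrict_mem measurableSet_Ioo] with t ht using (hσ0 t (hsub ht)).le
    · rw [inter_eq_right.2 fun t ht => Function.mem_support.2 (hσ0 t (hsub ht)).ne']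
      simpa using hr.2
  have hW0 : ∀ r ∈ Ioo (0 : ℝ) 1, 0 < W r := fun r hr => by
    rw [hW]
    have hsub : Ioo 0 r ⊆ Ioo 0 1 := Ioo_subset_Ioo_right hr.2.le
    refine (setIntegral_pos_iff_support_of_nonneg_ae ?_ (hw r hr)).2 ?_
    · filter_upwards [ae_restrict_mem measurableSet_Ioo] with t ht using (hw0 t (hsub ht)).le
    · rw [inter_eq_right.2 fun t ht => Function.mem_support.2 (hw0 t (hsub ht)).ne']
      simpa using hr.1
  have hSa : AntitoneOn S (Ioo 0 1) := by
    refine antitoneOn_of_deriv_nonpos (convex_Ioo 0 1)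
      (fun x hx => (hSd x hx).continuousAt.continuousWithinAt) ?_ ?_ <;>
      rw [interior_Ioo]
    · exact fun x hx => (hSd x hx).differentiableAt.differentiableWithinAt
    · intro x hx
      rw [(hSd x hx).deriv]
      linarith [hσ0 x hx]
  have hWm : MonotoneOn W (Ioo 0 1) := by
    refine monotoneOn_of_deriv_nonneg (convex_Ioo 0 1)
      (fun x hx => (hWd x hx).continuousAt.continuousWithinAt) ?_ ?_ <;>
      rw [interior_Ioo]
    · exact fun x hx => (hWd x hx).differentiableAt.differentiableWithinAt
    · intro x hx
      rw [(hWd x hx).deriv]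
      exact (hw0 x hx).le
  have hSc : ContinuousOn S (Ioo 0 1) := fun x hx => (hSd x hx).continuousAt.continuousWithinAt
  have hB0 : 0 < B := by
    have h : (1 / 2 : ℝ) ∈ Ioo (0 : ℝ) 1 := by norm_num
    have h1 := hS0 _ h
    have h2 := hW0 _ h
    exact lt_of_lt_of_le (by positivity) (hB _ h)
  have hTm : AEMeasurable (fun r => ENNReal.ofReal (T r)) (volume.restrict (Ioo 0 1)) :=
    (hTc.aemeasurable measurableSet_Ioo).ennreal_ofReal
  have hwm : AEMeasurable (fun r => ENNReal.ofReal (w r)) (volume.restrict (Ioo 0 1)) :=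
    (hwc.aemeasurable measurableSet_Ioo).ennreal_ofReal
  have hσm : AEMeasurable σ (volume.restrict (Ioo 0 1)) := hσc.aemeasurable measurableSet_Ioo
  have hSm : AEMeasurable S (volume.restrict (Ioo 0 1)) := hSc.aemeasurable measurableSet_Ioo
  have hwe : ∀ t, (1 - t) ^ (-p) * T t = w t := fun t => by rw [hwd]
  simp only [hwe]
  refine ⟨q ^ (p - 1) * p * B, fun φ hφ => ?_⟩
  -- Since `S' = -σ`, the function `σ S^{-1/p}` has primitive `-q S^{1/q}`, which dictates `b`.
  -- Since `σ^{p-1} = 1/T`, the target `a^{p-1} T` of the second condition is `S^{-(p-1)/p}`.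
  refine schur_test hp (k := fun r t => if r < t then 1 else 0)
    (a := fun t => ENNReal.ofReal (σ t * S t ^ (-(1 / p))))
    (b := fun r => ENNReal.ofReal (q * S r ^ q⁻¹))
    ?_ hφ (by fun_prop) (by fun_prop) hwm hTm ?_ ?_ ?_ ?_
  · exact Measurable.ite (measurableSet_lt measurable_fst measurable_snd) measurable_const
      measurable_const
  · filter_upwards [ae_restrict_mem measurableSet_Ioo] with t ht
    have h1 := hσ0 t ht
    have h2 := hS0 t ht
    simp only [ne_eq, ENNReal.ofReal_eq_zero, not_le]; positivity
  · exact Filter.Eventually.of_forall fun t => ENNReal.ofReal_ne_top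
  · filter_upwards [ae_restrict_mem measurableSet_Ioo] with r hr
    have hsub : ∀ t ∈ Ioo r 1, t ∈ Ioo (0 : ℝ) 1 := fun t ht => ⟨hr.1.trans ht.1, ht.2⟩
    simp only [ite_mul, zero_mul, one_mul]
    rw [setLIntegral_ite_gt hr]
    refine lintegral_deriv_le (H := fun t => q * S r ^ q⁻¹ - q * S t ^ q⁻¹) ?_ ?_ ?_ ?_
    · intro x hx
      refine ((((hSd x (hsub x hx)).rpow_const (p := q⁻¹)
        (Or.inl (hS0 x (hsub x hx)).ne')).const_mul q).const_sub (q * S r ^ q⁻¹)).congr_deriv ?_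
      have : q⁻¹ - 1 = -(1 / p) := by rw [hqi]; ring
      rw [this]
      field_simp
    · intro x hx
      have h1 := hσ0 x (hsub x hx)
      have h2 := hS0 x (hsub x hx)
      positivity
    · intro x hx
      have h2 := hS0 x (hsub x hx)
      have h3 := hSa hr (hsub x hx) hx.1.le
      have : q * S x ^ q⁻¹ ≤ q * S r ^ q⁻¹ := by gcongr
      linarith
    · intro x hx
      have h2 := hS0 x (hsub x hx)
      have : 0 ≤ q * S x ^ q⁻¹ := by positivity
      linarith
  · filter_upwards [ae_restrict_mem measurableSet_Ioo] with t ht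
    have hsub : ∀ r ∈ Ioo 0 t, r ∈ Ioo (0 : ℝ) 1 := fun r hr => ⟨hr.1, hr.2.trans ht.2⟩
    have hSt := hS0 t ht
    have hWt := hW0 t ht
    have hTt := hT0 t ht
    simp only [mul_ite, ite_mul, mul_zero, zero_mul, mul_one]
    rw [setLIntegral_ite_lt ht]
    -- The condition `S^{p-1} W ≤ B` is used twice: raised to the power `1/q`, it trades `S` for `W`
    -- under the integral, leaving the exact derivative `w W^{1/p-1}` of `p W^{1/p}`; raised to
    -- `1/p`, it trades `W t` back for `S t`. The two powers of `B` multiply to `B`.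
    calc ∫⁻ r in Ioo 0 t, ENNReal.ofReal (w r) * ENNReal.ofReal (q * S r ^ q⁻¹) ^ (p - 1)
        ≤ ∫⁻ r in Ioo 0 t, ENNReal.ofReal (q ^ (p - 1) * B ^ q⁻¹) *
            ENNReal.ofReal (w r * W r ^ (1 / p - 1)) := by
          refine setLIntegral_mono' measurableSet_Ioo fun r hr => ?_
          have h1 := hS0 r (hsub r hr)
          have h2 := hW0 r (hsub r hr)
          have h3 := hw0 r (hsub r hr)
          rw [ENNReal.ofReal_rpow_of_nonneg (by positivity) hp1.le,
            ← ENNReal.ofReal_mul h3.le, ← ENNReal.ofReal_mul (by positivity)]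
          refine ENNReal.ofReal_le_ofReal ?_
          have e1 : (q * S r ^ q⁻¹) ^ (p - 1) = q ^ (p - 1) * (S r ^ (p - 1)) ^ q⁻¹ := by
            rw [Real.mul_rpow (by positivity) (by positivity), ← Real.rpow_mul h1.le,
              ← Real.rpow_mul h1.le, mul_comm q⁻¹]
          have e2 : (S r ^ (p - 1)) ^ q⁻¹ ≤ B ^ q⁻¹ * W r ^ (1 / p - 1) := by
            have : 1 / p - 1 = -q⁻¹ := by rw [hqi]; ring
            rw [this, Real.rpow_neg h2.le, ← div_eq_mul_inv, ← Real.div_rpow hB0.le h2.le]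
            refine Real.rpow_le_rpow (by positivity) ?_ (by positivity)
            rw [le_div_iff₀ h2]
            exact hB r (hsub r hr)
          rw [e1]
          calc w r * (q ^ (p - 1) * (S r ^ (p - 1)) ^ q⁻¹)
              ≤ w r * (q ^ (p - 1) * (B ^ q⁻¹ * W r ^ (1 / p - 1))) := by gcongr
            _ = _ := by ring
      _ = ENNReal.ofReal (q ^ (p - 1) * B ^ q⁻¹) *
            ∫⁻ r in Ioo 0 t, ENNReal.ofReal (w r * W r ^ (1 / p - 1)) :=
          lintegral_const_mul' _ _ ENNReal.ofReal_ne_top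
      _ ≤ ENNReal.ofReal (q ^ (p - 1) * B ^ q⁻¹) * ENNReal.ofReal (p * W t ^ (1 / p)) := by
          gcongr
          refine lintegral_deriv_le (H := fun r => p * W r ^ (1 / p)) ?_ ?_ ?_ ?_
          · intro x hx
            refine (((hWd x (hsub x hx)).rpow_const (p := 1 / p)
              (Or.inl (hW0 x (hsub x hx)).ne')).const_mul p).congr_deriv ?_
            field_simp
          · intro x hx
            have h1 := hw0 x (hsub x hx)
            have h2 := hW0 x (hsub x hx)
            positivity
          · intro x hx
            have h2 := hW0 x (hsub x hx)
            positivity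
          · intro x hx
            have h2 := hW0 x (hsub x hx)
            have h3 := hWm (hsub x hx) ht hx.2.le
            gcongr
      _ ≤ ENNReal.ofReal (q ^ (p - 1) * p * B * S t ^ (-((p - 1) / p))) := by
          rw [← ENNReal.ofReal_mul (by positivity)]
          refine ENNReal.ofReal_le_ofReal ?_
          have e : W t ^ (1 / p) ≤ B ^ (1 / p) * S t ^ (-((p - 1) / p)) := by
            have : S t ^ (-((p - 1) / p)) = ((S t ^ (p - 1)) ^ (1 / p))⁻¹ := by
              rw [Real.rpow_neg hSt.le, ← Real.rpow_mul hSt.le]; congr 2; ring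
            rw [this, ← div_eq_mul_inv, ← Real.div_rpow hB0.le (by positivity)]
            refine Real.rpow_le_rpow hWt.le ?_ (by positivity)
            rw [le_div_iff₀ (by positivity), mul_comm]
            exact hB t ht
          have eB : B ^ q⁻¹ * B ^ (1 / p) = B := by
            rw [← Real.rpow_add hB0, hqi]; simp
          calc q ^ (p - 1) * B ^ q⁻¹ * (p * W t ^ (1 / p))
              ≤ q ^ (p - 1) * B ^ q⁻¹ * (p * (B ^ (1 / p) * S t ^ (-((p - 1) / p)))) := by gcongr
            _ = q ^ (p - 1) * p * (B ^ q⁻¹ * B ^ (1 / p)) * S t ^ (-((p - 1) / p)) := by ring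
            _ = _ := by rw [eB]
      _ = _ := by
          have h1 := hσ0 t ht
          rw [ENNReal.ofReal_rpow_of_nonneg (by positivity) hp1.le,
            ← ENNReal.ofReal_mul (by positivity), ← ENNReal.ofReal_mul (by positivity)]
          congr 2
          rw [Real.mul_rpow h1.le (by positivity), ← Real.rpow_mul hSt.le]
          have : σ t ^ (p - 1) = (T t)⁻¹ := by
            rw [hσd]
            simp only
            rw [← Real.rpow_mul hTt.le, neg_mul, one_div_mul_cancel hp1.ne', Real.rpow_neg_one]
          rw [this]
          have : -(1 / p) * (p - 1) = -((p - 1) / p) := by ring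
          rw [this]
          field_simp

/-! ### Regular weights and their tails -/

lemma ofReal_mem_disc {r : ℝ} (hr : r ∈ Ico (0 : ℝ) 1) : (r : ℂ) ∈ disc := by
  simp only [disc, Metric.mem_ball, dist_zero_right, Complex.norm_real, Real.norm_eq_abs]
  rw [abs_of_nonneg hr.1]
  exact hr.2

lemma isOpen_disc : IsOpen disc := Metric.isOpen_ball

lemma continuousOn_ofReal_disc {E : Type*} [TopologicalSpace E] {g : ℂ → E}
    (hg : ContinuousOn g disc) : ContinuousOn (fun r : ℝ => g r) (Ico 0 1) :=
  hg.comp Complex.continuous_ofReal.continuousOn fun _ hr => ofReal_mem_disc hr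

namespace IsRegular

variable {ω : ℂ → ℝ}

lemma pos_ofReal (h : IsRegular ω) {r : ℝ} (hr : r ∈ Ico (0 : ℝ) 1) : 0 < ω (r : ℂ) :=
  h.pos _ (ofReal_mem_disc hr)

/-- The lower distortion bound gives positivity without integrability of `ω` along the radius, which
is not yet known. -/
lemma tail_pos (h : IsRegular ω) {r : ℝ} (hr : r ∈ Ico (0 : ℝ) 1) : 0 < tail ω r := by
  obtain ⟨c, C, hc, -, hd⟩ := h.distortion_asymp
  have h1 := (hd r hr).1
  have h2 : 0 < c * (1 - r) := mul_pos hc (by linarith [hr.2])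
  exact (pos_iff_pos_of_mul_pos (h2.trans_le h1)).1 (one_div_pos.2 (h.pos_ofReal hr))

/-- A Bochner integral of a non-integrable function is `0` by convention, so a positive tail forces
integrability. -/
lemma integrableOn_tail (h : IsRegular ω) {r : ℝ} (hr : r ∈ Ico (0 : ℝ) 1) :
    IntegrableOn (fun s : ℝ => ω s) (Ioo r 1) := by
  by_contra hn
  exact (h.tail_pos hr).ne' (integral_undef hn)

lemma hasDerivAt_tail (h : IsRegular ω) {r : ℝ} (hr : r ∈ Ioo (0 : ℝ) 1) :
    HasDerivAt (tail ω) (-ω r) r :=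
  hasDerivAt_integral_Ioo_right (g := fun s : ℝ => ω s) hr
    ((continuousOn_ofReal_disc h.continuousOn).mono Ioo_subset_Ico_self)
    (h.integrableOn_tail ⟨hr.1.le, hr.2⟩)

lemma continuousOn_tail (h : IsRegular ω) : ContinuousOn (tail ω) (Ioo 0 1) :=
  fun _ hx => (h.hasDerivAt_tail hx).continuousAt.continuousWithinAt

lemma tail_antitoneOn (h : IsRegular ω) : AntitoneOn (tail ω) (Ico 0 1) := by
  intro r hr s hs hrs
  refine setIntegral_mono_set (h.integrableOn_tail hr) ?_
    (Ioo_subset_Ioo_left hrs).eventuallyLE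
  filter_upwards [ae_restrict_mem measurableSet_Ioo] with t ht
  exact (h.pos_ofReal ⟨hr.1.trans ht.1.le, ht.2⟩).le

lemma exists_tail_le (h : IsRegular ω) :
    ∃ C : ℝ, 0 < C ∧ ∀ r ∈ Ico (0 : ℝ) 1, tail ω r ≤ C * ((1 - r) * ω r) := by
  obtain ⟨c, C, -, hC, hd⟩ := h.distortion_asymp
  refine ⟨C, hC, fun r hr => ?_⟩
  have h1 := (hd r hr).2
  have h2 := h.pos_ofReal hr
  rw [distortion, one_div_mul_eq_div, div_le_iff₀ h2] at h1
  linarith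

lemma exists_le_tail (h : IsRegular ω) :
    ∃ C : ℝ, 0 < C ∧ ∀ r ∈ Ico (0 : ℝ) 1, (1 - r) * ω r ≤ C * tail ω r := by
  obtain ⟨c, C, hc, -, hd⟩ := h.distortion_asymp
  refine ⟨c⁻¹, by positivity, fun r hr => ?_⟩
  have h1 := (hd r hr).1
  have h2 := h.pos_ofReal hr
  rw [distortion, one_div_mul_eq_div, le_div_iff₀ h2] at h1
  rw [inv_mul_eq_div, le_div_iff₀ hc]
  linarith

/-- The tail of a regular weight decreases at most polynomially. -/
lemma tail_mul_rpow_le (h : IsRegular ω) {κ : ℝ}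
    (hκ : ∀ r ∈ Ico (0 : ℝ) 1, (1 - r) * ω r ≤ κ * tail ω r) {t r : ℝ} (ht : t ∈ Ioo (0 : ℝ) 1)
    (hr : r ∈ Ioo (0 : ℝ) 1) (htr : t ≤ r) :
    tail ω t * (1 - r) ^ κ ≤ tail ω r * (1 - t) ^ κ := by
  -- The derivative equals `(1-x)^{-κ-1} (κ · tail ω x - (1-x) ω x)`, nonnegative by `hκ`.
  have hd : ∀ x ∈ Ioo (0 : ℝ) 1, HasDerivAt (fun x => tail ω x * (1 - x) ^ (-κ))
      (-ω x * (1 - x) ^ (-κ) + tail ω x * -(-κ * (1 - x) ^ (-κ - 1))) x := fun x hx =>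
    (h.hasDerivAt_tail hx).mul (hasDerivAt_one_sub_rpow hx.2 (-κ))
  have hm : MonotoneOn (fun x => tail ω x * (1 - x) ^ (-κ)) (Ioo 0 1) := by
    refine monotoneOn_of_deriv_nonneg (convex_Ioo 0 1)
      (fun x hx => (hd x hx).continuousAt.continuousWithinAt) ?_ ?_ <;>
      rw [interior_Ioo]
    · exact fun x hx => (hd x hx).differentiableAt.differentiableWithinAt
    · intro x hx
      rw [(hd x hx).deriv]
      have h1 : 0 < 1 - x := by linarith [hx.2]
      have e : (1 - x) ^ (-κ) = (1 - x) * (1 - x) ^ (-κ - 1) := by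
        rw [Real.rpow_sub_one h1.ne']; field_simp
      rw [e]
      have h2 := hκ x ⟨hx.1.le, hx.2⟩
      have h3 : 0 ≤ (1 - x) ^ (-κ - 1) := by positivity
      nlinarith
  have h1 := hm ht hr htr
  have ht1 : 0 < 1 - t := by linarith [ht.2]
  have hr1 : 0 < 1 - r := by linarith [hr.2]
  simp only [Real.rpow_neg ht1.le, Real.rpow_neg hr1.le, ← div_eq_mul_inv] at h1
  rwa [div_le_div_iff₀ (by positivity) (by positivity)] at h1

end IsRegular

/-! ### The Muckenhoupt condition in real-valued form -/

lemma setLIntegral_ofReal_ne_zero {g : ℝ → ℝ} {a b : ℝ} (hab : a < b)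
    (hg : AEMeasurable g (volume.restrict (Ioo a b))) (h0 : ∀ t ∈ Ioo a b, 0 < g t) :
    ∫⁻ t in Ioo a b, ENNReal.ofReal (g t) ≠ 0 := by
  rw [Ne, lintegral_eq_zero_iff' hg.ennreal_ofReal]
  intro h
  have hf : ∀ᵐ t ∂(volume.restrict (Ioo a b)), False := by
    filter_upwards [h, ae_restrict_mem measurableSet_Ioo] with t ht hmem
    simp only [Pi.zero_apply, ENNReal.ofReal_eq_zero] at ht
    exact absurd (h0 t hmem) (not_lt.2 ht)
  rw [ae_iff] at hf
  simp only [not_false_eq_true, ofPred_true, Measure.restrict_apply_univ, Real.volume_Ioo,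
    ENNReal.ofReal_eq_zero] at hf
  linarith

/-- The Muckenhoupt condition in terms of Bochner integrals. -/
lemma IsMuckenhoupt.exists_bound {p : ℝ} (hp : 1 < p) {ω : ℂ → ℝ} (hR : IsRegular ω)
    (hM : IsMuckenhoupt p ω) :
    ∃ B : ℝ, ∀ r ∈ Ioo (0 : ℝ) 1,
      IntegrableOn (fun t => tail ω t ^ (-(1 / (p - 1)))) (Ioo r 1) ∧
      IntegrableOn (fun t => (1 - t) ^ (-p) * tail ω t) (Ioo 0 r) ∧
      (∫ t in Ioo r 1, tail ω t ^ (-(1 / (p - 1)))) ^ (p - 1) *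
        ∫ t in Ioo 0 r, (1 - t) ^ (-p) * tail ω t ≤ B := by
  have hp0 : 0 < p := by linarith
  have hp1 : 0 < p - 1 := by linarith
  have e1 : p.conjExponent / p = 1 / (p - 1) := by rw [Real.conjExponent]; field_simp
  have e2 : p / p.conjExponent = p - 1 := by rw [Real.conjExponent]; field_simp
  obtain ⟨σ, hσd⟩ : ∃ σ : ℝ → ℝ, σ = fun t => tail ω t ^ (-(1 / (p - 1))) := ⟨_, rfl⟩
  obtain ⟨w, hwd⟩ : ∃ w : ℝ → ℝ, w = fun t => (1 - t) ^ (-p) * tail ω t := ⟨_, rfl⟩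
  have hsup := hM.sup_lt_top
  rw [e1, e2] at hsup
  obtain ⟨M, hMdef⟩ : ∃ M : ℝ≥0∞, M = ⨆ r ∈ Ico (0 : ℝ) 1,
      (∫⁻ t in Ioo r 1, ENNReal.ofReal (tail ω t ^ (-(1 / (p - 1))))) ^ (p - 1) *
        ∫⁻ t in Ioo 0 r, ENNReal.ofReal ((1 - t) ^ (-p) * tail ω t) := ⟨_, rfl⟩
  rw [← hMdef] at hsup
  refine ⟨M.toReal, fun r hr => ?_⟩
  have hle : (∫⁻ t in Ioo r 1, ENNReal.ofReal (σ t)) ^ (p - 1) *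
        ∫⁻ t in Ioo 0 r, ENNReal.ofReal (w t) ≤ M := by
    rw [hMdef, hσd, hwd]
    exact le_iSup₂ (f := fun (r : ℝ) (_ : r ∈ Ico (0 : ℝ) 1) =>
      (∫⁻ t in Ioo r 1, ENNReal.ofReal (tail ω t ^ (-(1 / (p - 1))))) ^ (p - 1) *
        ∫⁻ t in Ioo 0 r, ENNReal.ofReal ((1 - t) ^ (-p) * tail ω t)) r ⟨hr.1.le, hr.2⟩
  have hT0 : ∀ t ∈ Ioo (0 : ℝ) 1, 0 < tail ω t := fun t ht => hR.tail_pos ⟨ht.1.le, ht.2⟩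
  have hσ0 : ∀ t ∈ Ioo (0 : ℝ) 1, 0 < σ t := fun t ht => by
    have := hT0 t ht
    rw [hσd]; positivity
  have hw0 : ∀ t ∈ Ioo (0 : ℝ) 1, 0 < w t := fun t ht => by
    have := hT0 t ht
    have : 0 < 1 - t := by linarith [ht.2]
    rw [hwd]; positivity
  have hσc : ContinuousOn σ (Ioo 0 1) := by
    rw [hσd]
    exact hR.continuousOn_tail.rpow_const fun t ht => Or.inl (hT0 t ht).ne'
  have hwc : ContinuousOn w (Ioo 0 1) := by
    rw [hwd]
    refine ContinuousOn.mul (ContinuousOn.rpow_const (by fun_prop) fun t ht => Or.inl ?_)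
      hR.continuousOn_tail
    exact (sub_pos.2 ht.2).ne'
  have hsub1 : Ioo r 1 ⊆ Ioo 0 1 := Ioo_subset_Ioo_left hr.1.le
  have hsub2 : Ioo 0 r ⊆ Ioo 0 1 := Ioo_subset_Ioo_right hr.2.le
  have hσm : AEStronglyMeasurable σ (volume.restrict (Ioo r 1)) :=
    (hσc.mono hsub1).aestronglyMeasurable measurableSet_Ioo
  have hwm : AEStronglyMeasurable w (volume.restrict (Ioo 0 r)) :=
    (hwc.mono hsub2).aestronglyMeasurable measurableSet_Ioo
  -- A finite product in `[0, ∞]` could hide `0 · ∞`. Both factors are nonzero for `0 < r < 1`, so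
  -- each is finite.
  have hA0 : ∫⁻ t in Ioo r 1, ENNReal.ofReal (σ t) ≠ 0 :=
    setLIntegral_ofReal_ne_zero hr.2 hσm.aemeasurable fun t ht => hσ0 t (hsub1 ht)
  have hW0 : ∫⁻ t in Ioo 0 r, ENNReal.ofReal (w t) ≠ 0 :=
    setLIntegral_ofReal_ne_zero hr.1 hwm.aemeasurable fun t ht => hw0 t (hsub2 ht)
  have hA : ∫⁻ t in Ioo r 1, ENNReal.ofReal (σ t) ≠ ∞ := fun h => by
    rw [h, ENNReal.top_rpow_of_pos hp1, ENNReal.top_mul hW0] at hle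
    exact absurd hle (not_le.2 hsup)
  have hW : ∫⁻ t in Ioo 0 r, ENNReal.ofReal (w t) ≠ ∞ := fun h => by
    rw [h, ENNReal.mul_top] at hle
    · exact absurd hle (not_le.2 hsup)
    · simp [ENNReal.rpow_eq_zero_iff, hA0, hA]
  have hσn : 0 ≤ᵐ[volume.restrict (Ioo r 1)] σ := by
    filter_upwards [ae_restrict_mem measurableSet_Ioo] with t ht using (hσ0 t (hsub1 ht)).le
  have hwn : 0 ≤ᵐ[volume.restrict (Ioo 0 r)] w := by
    filter_upwards [ae_restrict_mem measurableSet_Ioo] with t ht using (hw0 t (hsub2 ht)).le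
  have hσi : IntegrableOn σ (Ioo r 1) :=
    (lintegral_ofReal_ne_top_iff_integrable hσm hσn).1 hA
  have hwi : IntegrableOn w (Ioo 0 r) :=
    (lintegral_ofReal_ne_top_iff_integrable hwm hwn).1 hW
  rw [hσd] at hσi
  rw [hwd] at hwi
  refine ⟨hσi, hwi, ?_⟩
  rw [← hσd] at hσi
  rw [← hwd] at hwi
  have hσI : 0 ≤ ∫ t in Ioo r 1, σ t := integral_nonneg_of_ae hσn
  rw [← ofReal_integral_eq_lintegral_ofReal hσi hσn,
    ← ofReal_integral_eq_lintegral_ofReal hwi hwn,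
    ENNReal.ofReal_rpow_of_nonneg hσI hp1.le, ← ENNReal.ofReal_mul (by positivity)] at hle
  rw [hσd, hwd] at hle
  exact (ENNReal.ofReal_le_iff_le_toReal hsup.ne).1 hle

/-! ### The Stieltjes transform on the radius -/

/-- The Stieltjes transform `∫_0^1 φ(t) / (1 - t + s) dt`. -/
noncomputable def stieltjes (φ : ℝ → ℝ≥0∞) (s : ℝ) : ℝ≥0∞ :=
  ∫⁻ t in Ioo (0 : ℝ) 1, φ t * ENNReal.ofReal (1 - t + s)⁻¹

/-- This monotonicity makes the transform an admissible `G` in `IsRegular.exists_lintegral_disc_le`.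
-/
lemma stieltjes_antitoneOn (φ : ℝ → ℝ≥0∞) : AntitoneOn (stieltjes φ) (Ioi 0) := by
  intro s hs s' hs' h
  refine setLIntegral_mono' measurableSet_Ioo fun t ht => ?_
  gcongr
  have := ht.2
  have : 0 < s := hs
  linarith

/-- The Stieltjes transform is bounded on `L^p(tail ω)`. -/
lemma exists_stieltjes_le {p : ℝ} (hp : 1 < p) {ω : ℂ → ℝ} (hR : IsRegular ω)
    (hM : IsMuckenhoupt p ω) :
    ∃ C : ℝ, ∀ φ : ℝ → ℝ≥0∞, AEMeasurable φ (volume.restrict (Ioo 0 1)) →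
      ∫⁻ r in Ioo (0 : ℝ) 1, ENNReal.ofReal (tail ω r) * stieltjes φ (1 - r) ^ p ≤
      ENNReal.ofReal C * ∫⁻ t in Ioo (0 : ℝ) 1, φ t ^ p * ENNReal.ofReal (tail ω t) := by
  have hp0 : 0 < p := by linarith
  obtain ⟨B, hB⟩ := hM.exists_bound hp hR
  obtain ⟨C₁, h₁⟩ := muckenhoupt_hardy hp (T := tail ω)
    (fun t ht => hR.tail_pos ⟨ht.1.le, ht.2⟩) hR.continuousOn_tail (fun r hr => (hB r hr).1)
    (fun r hr => (hB r hr).2.1) (fun r hr => (hB r hr).2.2)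
  obtain ⟨C₂, h₂⟩ := adjoint_hardy hp (hR.tail_antitoneOn.mono Ioo_subset_Ico_self)
    hR.continuousOn_tail
  -- `2^{p-1}` is the convexity constant for `(x + y)^p`. Positive parts are taken because
  -- `ENNReal.ofReal` is additive only on nonnegative reals.
  refine ⟨2 ^ (p - 1) * (max C₁ 0 + max C₂ 0), fun φ hφ => ?_⟩
  obtain ⟨A, hA⟩ : ∃ A : ℝ → ℝ≥0∞, A = fun r =>
    ∫⁻ t in Ioo (0 : ℝ) 1, (if r < t then 1 else 0) * φ t := ⟨_, rfl⟩
  obtain ⟨D, hD⟩ : ∃ D : ℝ → ℝ≥0∞, D = fun r => ∫⁻ t in Ioo (0 : ℝ) 1,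
    (if t < r then ENNReal.ofReal (1 - t)⁻¹ else 0) * φ t := ⟨_, rfl⟩
  -- `D` is monotone, hence measurable; measurability of one summand suffices to split the integral
  -- below.
  have hDm : Measurable D := by
    rw [hD]
    refine Monotone.measurable fun r s hrs => lintegral_mono fun t => ?_
    gcongr
    split_ifs with h1 h2 h2
    · exact le_rfl
    · exact absurd (h1.trans_le hrs) h2
    · exact zero_le
    · exact le_rfl
  have hTm : AEMeasurable (fun r => ENNReal.ofReal (tail ω r)) (volume.restrict (Ioo 0 1)) :=
    (hR.continuousOn_tail.aemeasurable measurableSet_Ioo).ennreal_ofReal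
  have hTDm : AEMeasurable (fun r => ENNReal.ofReal (tail ω r) * D r ^ p)
      (volume.restrict (Ioo 0 1)) := hTm.mul (hDm.pow_const p).aemeasurable
  have hpt : ∀ r ∈ Ioo (0 : ℝ) 1,
      ENNReal.ofReal (tail ω r) * stieltjes φ (1 - r) ^ p ≤
      2 ^ (p - 1) * (ENNReal.ofReal ((1 - r) ^ (-p) * tail ω r) * A r ^ p +
        ENNReal.ofReal (tail ω r) * D r ^ p) := by
    intro r hr
    have h1r : 0 < 1 - r := by linarith [hr.2]
    have hs : stieltjes φ (1 - r) ≤ ENNReal.ofReal (1 - r)⁻¹ * A r + D r := by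
      rw [hA, hD, stieltjes]
      simp only
      rw [← lintegral_const_mul' _ _ ENNReal.ofReal_ne_top, ← lintegral_add_left']
      · refine lintegral_mono_ae ?_
        filter_upwards [ae_restrict_mem measurableSet_Ioo,
          ae_restrict_of_ae (Measure.ae_ne volume r)] with t ht hne
        have h1t : 0 < 1 - t := by linarith [ht.2]
        rcases lt_or_gt_of_ne hne with h | h
        · rw [if_neg h.not_gt, if_pos h, zero_mul, mul_zero, zero_add, mul_comm]
          gcongr
          linarith
        · rw [if_pos h, if_neg h.not_gt, zero_mul, add_zero, one_mul, mul_comm]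
          gcongr
          linarith
      · refine AEMeasurable.const_mul (AEMeasurable.mul ?_ hφ) _
        exact (Measurable.ite measurableSet_Ioi measurable_const measurable_const).aemeasurable
    calc ENNReal.ofReal (tail ω r) * stieltjes φ (1 - r) ^ p
        ≤ ENNReal.ofReal (tail ω r) * (ENNReal.ofReal (1 - r)⁻¹ * A r + D r) ^ p := by gcongr
      _ ≤ ENNReal.ofReal (tail ω r) *
          (2 ^ (p - 1) * ((ENNReal.ofReal (1 - r)⁻¹ * A r) ^ p + D r ^ p)) := by
          gcongr
          exact ENNReal.rpow_add_le_mul_rpow_add_rpow _ _ hp.le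
      _ = _ := by
          rw [ENNReal.mul_rpow_of_nonneg _ _ hp0.le,
            ENNReal.ofReal_rpow_of_nonneg (by positivity) hp0.le, Real.inv_rpow h1r.le,
            ← Real.rpow_neg h1r.le, ENNReal.ofReal_mul (by positivity)]
          ring
  have e2 : (2 : ℝ≥0∞) ^ (p - 1) = ENNReal.ofReal (2 ^ (p - 1)) := by
    rw [← ENNReal.ofReal_rpow_of_pos (by norm_num)]; simp
  calc ∫⁻ r in Ioo (0 : ℝ) 1, ENNReal.ofReal (tail ω r) * stieltjes φ (1 - r) ^ p
      ≤ ∫⁻ r in Ioo (0 : ℝ) 1,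
        2 ^ (p - 1) * (ENNReal.ofReal ((1 - r) ^ (-p) * tail ω r) * A r ^ p +
        ENNReal.ofReal (tail ω r) * D r ^ p) := setLIntegral_mono' measurableSet_Ioo hpt
    _ = 2 ^ (p - 1) * ((∫⁻ r in Ioo (0 : ℝ) 1,
          ENNReal.ofReal ((1 - r) ^ (-p) * tail ω r) * A r ^ p) +
        ∫⁻ r in Ioo (0 : ℝ) 1, ENNReal.ofReal (tail ω r) * D r ^ p) := by
        rw [lintegral_const_mul' _ _ (by rw [e2]; exact ENNReal.ofReal_ne_top),
          lintegral_add_right' _ hTDm]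
    _ ≤ 2 ^ (p - 1) * (ENNReal.ofReal (max C₁ 0) *
          (∫⁻ t in Ioo (0 : ℝ) 1, φ t ^ p * ENNReal.ofReal (tail ω t)) +
          ENNReal.ofReal (max C₂ 0) *
          (∫⁻ t in Ioo (0 : ℝ) 1, φ t ^ p * ENNReal.ofReal (tail ω t))) := by
        gcongr
        · rw [hA]
          refine (h₁ φ hφ).trans ?_
          gcongr
          exact le_max_left _ _
        · rw [hD]
          refine (h₂ φ hφ).trans ?_
          gcongr
          exact le_max_left _ _
    _ = _ := by
        rw [← add_mul, ← mul_assoc, ENNReal.ofReal_mul (by positivity),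
          ENNReal.ofReal_add (by positivity) (by positivity), e2]

/-! ### From the disc to the radius -/

/-- Polar coordinates in a disc centred at the origin. -/
lemma lintegral_ball_polar (R : ℝ) (g : ℂ → ℝ≥0∞) :
    ∫⁻ z in Metric.ball 0 R, g z =
      ∫⁻ x, ENNReal.ofReal x.1 * g (circleMap 0 x.1 x.2)
        ∂((volume.restrict (Ioo 0 R)).prod (volume.restrict (Ioo (-Real.pi) Real.pi))) := by
  rw [← lintegral_indicator Metric.isOpen_ball.measurableSet,
    ← Complex.lintegral_comp_polarCoord_symm, Measure.prod_restrict, ← Measure.volume_eq_prod]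
  have htar : MeasurableSet (Ioi (0 : ℝ) ×ˢ Ioo (-Real.pi) Real.pi) :=
    measurableSet_Ioi.prod measurableSet_Ioo
  rw [polarCoord_target, ← lintegral_indicator htar,
    ← lintegral_indicator (measurableSet_Ioo.prod measurableSet_Ioo)]
  refine lintegral_congr fun x => ?_
  have hx : Complex.polarCoord.symm x = circleMap 0 x.1 x.2 := by
    rw [Complex.polarCoord_symm_apply, circleMap, zero_add, Complex.exp_mul_I]
    push_cast; rfl
  by_cases h1 : x ∈ Ioi (0 : ℝ) ×ˢ Ioo (-Real.pi) Real.pi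
  · have h0 : 0 < x.1 := h1.1
    have hn : ‖circleMap 0 x.1 x.2‖ = x.1 := by rw [norm_circleMap_zero, abs_of_pos h0]
    rw [indicator_of_mem h1, hx, smul_eq_mul]
    by_cases h2 : x.1 < R
    · rw [indicator_of_mem (by rwa [mem_ball_zero_iff, hn]),
        indicator_of_mem (by exact ⟨⟨h0, h2⟩, h1.2⟩)]
    · rw [indicator_of_notMem (by rwa [mem_ball_zero_iff, hn]),
        indicator_of_notMem (by exact fun h => h2 h.1.2), mul_zero]
  · rw [indicator_of_notMem h1, indicator_of_notMem (fun h => h1 ⟨h.1.1, h.2⟩)]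

/-- With `y = |θ|/π`, the bound `cos θ ≤ 1 - 2y²` gives `|1 - re^{iθ}|² ≥ (1-r)² + 4ry²`. As `y ≤
1`, this is at least `y²((1-r)² + 4r) = y²(1+r)² ≥ y²`. -/
lemma max_le_norm_one_sub_circleMap {r θ : ℝ} (hr : r ∈ Ioo (0 : ℝ) 1)
    (hθ : |θ| ≤ Real.pi) : max (1 - r) (|θ| / Real.pi) ≤ ‖1 - circleMap 0 r θ‖ := by
  have hpi := Real.pi_pos
  refine max_le ?_ ?_
  · have h := norm_sub_norm_le (1 : ℂ) (circleMap 0 r θ)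
    rwa [norm_circleMap_zero, abs_of_pos hr.1, norm_one] at h
  · have hc := Real.cos_le_one_sub_mul_cos_sq hθ
    obtain ⟨y, hy⟩ : ∃ y, y = |θ| / Real.pi := ⟨_, rfl⟩
    have hy0 : 0 ≤ y := by rw [hy]; positivity
    have hy1 : y ≤ 1 := by rw [hy, div_le_one hpi]; exact hθ
    have hys : 2 / Real.pi ^ 2 * θ ^ 2 = 2 * y ^ 2 := by
      rw [hy, div_pow, sq_abs]; ring
    rw [hys] at hc
    rw [← hy]
    refine le_of_sq_le_sq ?_ (norm_nonneg _)
    have hn : ‖1 - circleMap 0 r θ‖ ^ 2 = 1 - 2 * r * Real.cos θ + r ^ 2 := by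
      rw [← Complex.normSq_eq_norm_sq, Complex.normSq_apply, circleMap, zero_add,
        Complex.exp_mul_I, ← Complex.ofReal_cos, ← Complex.ofReal_sin]
      simp [-Complex.ofReal_cos, -Complex.ofReal_sin]
      nlinarith [Real.sin_sq_add_cos_sq θ]
    rw [hn]
    have h1 : r * Real.cos θ ≤ r * (1 - 2 * y ^ 2) := by
      have := hr.1.le
      gcongr
    nlinarith [mul_nonneg (sq_nonneg y) (mul_nonneg hr.1.le (by linarith [hr.1] : 0 ≤ 2 + r)),
      mul_nonneg (sub_nonneg.2 (pow_le_one₀ hy0 hy1 : y ^ 2 ≤ 1)) (sq_nonneg (1 - r))]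

lemma lintegral_areaMeasure_disc (g : ℂ → ℝ≥0∞) :
    ∫⁻ z in disc, g z ∂areaMeasure = ENNReal.ofReal Real.pi⁻¹ * ∫⁻ z in disc, g z := by
  rw [areaMeasure, Measure.restrict_smul, lintegral_smul_measure, smul_eq_mul]

/-- The substitutions `θ = ±π(1-r)` cover the interval up to the null set `{0}`, each with Jacobian
`π`. -/
lemma lintegral_abs_le (g : ℝ → ℝ≥0∞) :
    ∫⁻ θ in Ioo (-Real.pi) Real.pi, g (|θ| / Real.pi) ≤
      ENNReal.ofReal (2 * Real.pi) * ∫⁻ r in Ioo (0 : ℝ) 1, g (1 - r) := by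
  have hpi := Real.pi_pos
  have key : ∀ s : ℝ, |s| = 1 →
      ∫⁻ θ in (fun r => s * Real.pi * (1 - r)) '' Ioo 0 1, g (|θ| / Real.pi) =
        ENNReal.ofReal Real.pi * ∫⁻ r in Ioo (0 : ℝ) 1, g (1 - r) := by
    intro s hs
    have hs0 : s ≠ 0 := by rintro rfl; simp at hs
    rw [lintegral_image_eq_lintegral_abs_deriv_mul (f' := fun _ => -(s * Real.pi))
      measurableSet_Ioo, ← lintegral_const_mul' _ _ ENNReal.ofReal_ne_top]
    · refine setLIntegral_congr_fun measurableSet_Ioo fun r hr => ?_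
      have h1 : 0 < 1 - r := by linarith [hr.2]
      simp only [abs_neg, abs_mul, hs, abs_of_pos hpi, abs_of_pos h1, one_mul]
      rw [mul_div_cancel_left₀ _ hpi.ne']
    · intro x _
      refine HasDerivAt.hasDerivWithinAt ?_
      simpa using ((hasDerivAt_id x).const_sub 1).const_mul (s * Real.pi)
    · intro x _ y _ h
      have : s * Real.pi ≠ 0 := mul_ne_zero hs0 hpi.ne'
      have := mul_left_cancel₀ this h
      linarith
  have hsub : Ioo (-Real.pi) Real.pi ⊆ ((fun r => 1 * Real.pi * (1 - r)) '' Ioo 0 1 ∪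
      (fun r => -1 * Real.pi * (1 - r)) '' Ioo 0 1) ∪ {0} := by
    intro θ hθ
    rcases lt_trichotomy θ 0 with h | h | h
    · refine Or.inl (Or.inr ⟨1 + θ / Real.pi, ⟨?_, ?_⟩, ?_⟩)
      · have : -1 < θ / Real.pi := by rw [lt_div_iff₀ hpi]; linarith [hθ.1]
        linarith
      · have : θ / Real.pi < 0 := div_neg_of_neg_of_pos h hpi
        linarith
      · simp only; field_simp; ring
    · exact Or.inr h
    · refine Or.inl (Or.inl ⟨1 - θ / Real.pi, ⟨?_, ?_⟩, ?_⟩)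
      · have : θ / Real.pi < 1 := by rw [div_lt_one hpi]; exact hθ.2
        linarith
      · have : 0 < θ / Real.pi := div_pos h hpi
        linarith
      · simp only; field_simp; ring
  refine (lintegral_mono_set hsub).trans ((lintegral_union_le _ _ _).trans ?_)
  rw [setLIntegral_measure_zero {(0 : ℝ)} _ (by simp), add_zero]
  refine (lintegral_union_le _ _ _).trans (le_of_eq ?_)
  rw [key 1 (by simp), key (-1) (by simp), ← add_mul,
    ← ENNReal.ofReal_add hpi.le hpi.le, two_mul]

/-- Functions decreasing in the distance to the boundary point `1` integrate over the disc like
functions on the radius. -/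
lemma IsRegular.exists_lintegral_disc_le {ω : ℂ → ℝ} (hR : IsRegular ω) :
    ∃ C : ℝ, ∀ G : ℝ → ℝ≥0∞, AntitoneOn G (Ioi 0) →
      ∫⁻ z in disc, G ‖1 - z‖ * ENNReal.ofReal (ω z) ∂areaMeasure ≤
        ENNReal.ofReal C * ∫⁻ r in Ioo (0 : ℝ) 1, ENNReal.ofReal (tail ω r) * G (1 - r) := by
  obtain ⟨κ, hκ, hκT⟩ := hR.exists_le_tail
  have hpi := Real.pi_pos
  refine ⟨Real.pi⁻¹ * (2 * Real.pi * κ + 2 * Real.pi), fun G hG => ?_⟩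
  rw [lintegral_areaMeasure_disc, disc, lintegral_ball_polar]
  obtain ⟨μ, hμ⟩ : ∃ μ : Measure ℝ, μ = volume.restrict (Ioo 0 1) := ⟨_, rfl⟩
  obtain ⟨ν, hν⟩ : ∃ ν : Measure ℝ, ν = volume.restrict (Ioo (-Real.pi) Real.pi) := ⟨_, rfl⟩
  have : SFinite μ := by rw [hμ]; infer_instance
  have : SFinite ν := by rw [hν]; infer_instance
  -- `J₁` lives where `|θ|/π ≤ 1 - r`: its angles have measure at most `2π(1-r)`, and `(1-r)ω ≤ κ ·
  -- tail ω`. `J₂` lives on the complement: integrating `ω` over `r > 1 - |θ|/π` produces the tail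
  -- at `1 - |θ|/π`, a point that then runs over the radius.
  obtain ⟨J₁, hJ₁⟩ : ∃ J₁ : ℝ × ℝ → ℝ≥0∞, J₁ = fun x =>
    (if |x.2| / Real.pi ≤ 1 - x.1 then 1 else 0) * (ENNReal.ofReal (ω x.1) * G (1 - x.1)) :=
    ⟨_, rfl⟩
  obtain ⟨J₂, hJ₂⟩ : ∃ J₂ : ℝ × ℝ → ℝ≥0∞, J₂ = fun x =>
    G (|x.2| / Real.pi) * (if 1 - |x.2| / Real.pi < x.1 then ENNReal.ofReal (ω x.1) else 0) :=
    ⟨_, rfl⟩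
  rw [← hμ, ← hν]
  have hωm : AEMeasurable (fun r : ℝ => ENNReal.ofReal (ω r)) μ := by
    rw [hμ]
    exact (((continuousOn_ofReal_disc hR.continuousOn).mono Ioo_subset_Ico_self).aemeasurable
      measurableSet_Ioo).ennreal_ofReal
  have hGm : AEMeasurable (fun r : ℝ => G (1 - r)) μ := by
    rw [hμ]
    refine aemeasurable_restrict_of_monotoneOn measurableSet_Ioo fun r hr s hs hrs => ?_
    exact hG (sub_pos.2 hs.2) (sub_pos.2 hr.2) (by linarith)
  have hJm : AEMeasurable J₁ (μ.prod ν) := by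
    rw [hJ₁]
    refine AEMeasurable.mul (Measurable.aemeasurable ?_) (hωm.mul hGm).comp_fst
    exact Measurable.ite (measurableSet_le (by fun_prop) (by fun_prop)) measurable_const
      measurable_const
  have hle : ∫⁻ x, ENNReal.ofReal x.1 * (G ‖1 - circleMap 0 x.1 x.2‖ *
      ENNReal.ofReal (ω (circleMap 0 x.1 x.2))) ∂(μ.prod ν) ≤
      ∫⁻ x, J₁ x + J₂ x ∂(μ.prod ν) := by
    rw [hμ, hν, Measure.prod_restrict]
    refine setLIntegral_mono' (measurableSet_Ioo.prod measurableSet_Ioo) fun x hx => ?_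
    have hr : x.1 ∈ Ioo (0 : ℝ) 1 := hx.1
    have hθ : |x.2| ≤ Real.pi := abs_le.2 ⟨hx.2.1.le, hx.2.2.le⟩
    have hmax := max_le_norm_one_sub_circleMap hr hθ
    have hn : ‖circleMap 0 x.1 x.2‖ = x.1 := by rw [norm_circleMap_zero, abs_of_pos hr.1]
    have hωr : ω (circleMap 0 x.1 x.2) = ω x.1 := by
      rw [hR.radial _ (by rw [disc, mem_ball_zero_iff, hn]; exact hr.2), hn]
    have h1r : 0 < 1 - x.1 := sub_pos.2 hr.2
    rw [hωr]
    calc ENNReal.ofReal x.1 * (G ‖1 - circleMap 0 x.1 x.2‖ * ENNReal.ofReal (ω x.1))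
        ≤ 1 * (G (max (1 - x.1) (|x.2| / Real.pi)) * ENNReal.ofReal (ω x.1)) := by
          gcongr
          · exact ENNReal.ofReal_le_one.2 hr.2.le
          · exact hG (lt_max_of_lt_left h1r) (lt_of_lt_of_le (lt_max_of_lt_left h1r) hmax) hmax
      _ ≤ J₁ x + J₂ x := by
          rw [one_mul, hJ₁, hJ₂]
          rcases le_or_gt (|x.2| / Real.pi) (1 - x.1) with h | h
          · simp only
            rw [max_eq_left h, if_pos h, one_mul, mul_comm]
            exact le_self_add
          · simp only
            rw [max_eq_right h.le, if_pos (show 1 - |x.2| / Real.pi < x.1 by linarith)]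
            exact le_add_self
  have h1 : ∫⁻ x, J₁ x ∂(μ.prod ν) ≤ ENNReal.ofReal (2 * Real.pi * κ) *
      ∫⁻ r in Ioo (0 : ℝ) 1, ENNReal.ofReal (tail ω r) * G (1 - r) := by
    refine (lintegral_prod_le _).trans ?_
    rw [← lintegral_const_mul' _ _ ENNReal.ofReal_ne_top, hμ]
    refine setLIntegral_mono' measurableSet_Ioo fun r hr => ?_
    have h1r : 0 < 1 - r := sub_pos.2 hr.2
    have hω0 := hR.pos_ofReal ⟨hr.1.le, hr.2⟩
    have hvol : ∫⁻ θ, (if |θ| / Real.pi ≤ 1 - r then 1 else 0) ∂ν ≤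
        ENNReal.ofReal (2 * Real.pi * (1 - r)) := by
      have : (fun θ : ℝ => if |θ| / Real.pi ≤ 1 - r then (1 : ℝ≥0∞) else 0) =
          (Icc (-(Real.pi * (1 - r))) (Real.pi * (1 - r))).indicator 1 := by
        ext θ
        simp only [indicator, mem_Icc, Pi.one_apply, ← abs_le, div_le_iff₀' hpi]
      rw [this, lintegral_indicator_one measurableSet_Icc, hν]
      refine (Measure.restrict_apply_le _ _).trans ?_
      rw [Real.volume_Icc]
      exact ENNReal.ofReal_le_ofReal (by linarith)
    rw [hJ₁]
    simp only
    rw [lintegral_mul_const _ (Measurable.ite (measurableSet_le (by fun_prop) (by fun_prop))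
      measurable_const measurable_const), ← mul_assoc, ← mul_assoc]
    refine mul_le_mul' ?_ le_rfl
    calc _ ≤ ENNReal.ofReal (2 * Real.pi * (1 - r)) * ENNReal.ofReal (ω r) :=
          mul_le_mul' hvol le_rfl
      _ ≤ _ := by
        rw [← ENNReal.ofReal_mul (by positivity), ← ENNReal.ofReal_mul (by positivity)]
        refine ENNReal.ofReal_le_ofReal ?_
        have := hκT r ⟨hr.1.le, hr.2⟩
        nlinarith
  have h2 : ∫⁻ x, J₂ x ∂(μ.prod ν) ≤ ENNReal.ofReal (2 * Real.pi) *
      ∫⁻ r in Ioo (0 : ℝ) 1, ENNReal.ofReal (tail ω r) * G (1 - r) := by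
    -- The radius must be the inner variable here. The inequality `lintegral_prod_le` requires no
    -- measurability, so none is needed for `J₂`.
    rw [← lintegral_prod_swap]
    refine (lintegral_prod_le _).trans ?_
    refine le_trans ?_ ((lintegral_abs_le
      (fun y => ENNReal.ofReal (tail ω (1 - y)) * G y)).trans (le_of_eq (by simp)))
    rw [hν]
    refine lintegral_mono_ae ?_
    filter_upwards [ae_restrict_mem measurableSet_Ioo,
      ae_restrict_of_ae (Measure.ae_ne volume (0 : ℝ))] with θ hθ hθ0
    have hy0 : 0 < |θ| / Real.pi := div_pos (abs_pos.2 hθ0) hpi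
    have hy1 : |θ| / Real.pi < 1 := by rw [div_lt_one hpi]; exact abs_lt.2 hθ
    have hy : 1 - |θ| / Real.pi ∈ Ioo (0 : ℝ) 1 := ⟨by linarith, by linarith⟩
    simp only [hJ₂, Prod.fst_swap, Prod.snd_swap]
    have hm : AEMeasurable (fun r : ℝ =>
        if 1 - |θ| / Real.pi < r then ENNReal.ofReal (ω r) else 0) μ := by
      have : (fun r : ℝ => if 1 - |θ| / Real.pi < r then ENNReal.ofReal (ω r) else 0) =
          (Ioi (1 - |θ| / Real.pi)).indicator fun r : ℝ => ENNReal.ofReal (ω r) := by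
        ext r; simp [indicator]
      rw [this]
      exact hωm.indicator measurableSet_Ioi
    rw [lintegral_const_mul'' _ hm, mul_comm, hμ, setLIntegral_ite_gt hy]
    gcongr
    rw [tail, ofReal_integral_eq_lintegral_ofReal (hR.integrableOn_tail ⟨hy.1.le, hy.2⟩)]
    filter_upwards [ae_restrict_mem measurableSet_Ioo] with r hr
    exact (hR.pos_ofReal ⟨hy.1.le.trans hr.1.le, hr.2⟩).le
  calc _ ≤ ENNReal.ofReal Real.pi⁻¹ * ∫⁻ x, J₁ x + J₂ x ∂(μ.prod ν) := by gcongr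
    _ ≤ ENNReal.ofReal Real.pi⁻¹ * (ENNReal.ofReal (2 * Real.pi * κ) *
      (∫⁻ r in Ioo (0 : ℝ) 1, ENNReal.ofReal (tail ω r) * G (1 - r)) +
        ENNReal.ofReal (2 * Real.pi) *
      ∫⁻ r in Ioo (0 : ℝ) 1, ENNReal.ofReal (tail ω r) * G (1 - r)) := by
        rw [lintegral_add_left' hJm]
        gcongr
    _ = _ := by
        rw [hμ, ← add_mul, ← mul_assoc, ENNReal.ofReal_mul (inv_nonneg.2 hpi.le),
          ENNReal.ofReal_add (by positivity) (by positivity)]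

/-! ### Sub-mean value property and restriction to the radius -/

/-- This is Cauchy's mean value formula; periodicity moves the angle to `(-π, π)` to match polar
coordinates. -/
lemma norm_le_lintegral_circle {f : ℂ → ℂ} {c : ℂ} {R r : ℝ} (hr : r ∈ Ioo 0 R)
    (hf : DifferentiableOn ℂ f (Metric.ball c R)) :
    ENNReal.ofReal (2 * Real.pi) * ‖f c‖ₑ ≤
      ∫⁻ θ in Ioo (-Real.pi) Real.pi, ‖f (circleMap c r θ)‖ₑ := by
  have hpi := Real.pi_pos
  have hd : DiffContOnCl ℂ f (Metric.ball c |r|) := by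
    rw [abs_of_pos hr.1]
    refine (hf.mono ?_).diffContOnCl
    rw [closure_ball _ hr.1.ne']
    exact Metric.closedBall_subset_ball hr.2
  have havg := hd.circleAverage
  have hper : (fun θ => f (circleMap c r θ)).Periodic (2 * Real.pi) :=
    fun x => by simp [periodic_circleMap c r x]
  have hshift := hper.intervalIntegral_add_eq 0 (-Real.pi)
  rw [Real.circleAverage_def] at havg
  rw [zero_add] at hshift
  rw [hshift, show -Real.pi + 2 * Real.pi = Real.pi by ring,
    intervalIntegral.integral_of_le (by linarith), integral_Ioc_eq_integral_Ioo] at havg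
  have h2 : (∫ θ in Ioo (-Real.pi) Real.pi, f (circleMap c r θ)) = (2 * Real.pi) • f c := by
    rw [← havg, smul_smul, mul_inv_cancel₀ (by positivity), one_smul]
  calc ENNReal.ofReal (2 * Real.pi) * ‖f c‖ₑ = ‖(2 * Real.pi) • f c‖ₑ := by
        rw [enorm_smul, Real.enorm_of_nonneg (by positivity)]
    _ ≤ _ := by rw [← h2]; exact enorm_integral_le_lintegral_enorm _

lemma lintegral_ofReal_Ioo {R : ℝ} (hR : 0 < R) :
    ∫⁻ r in Ioo 0 R, ENNReal.ofReal r = ENNReal.ofReal (R ^ 2 / 2) := by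
  have hint : IntegrableOn (fun r : ℝ => r) (Ioo 0 R) :=
    (continuous_id.integrableOn_Icc).mono_set Ioo_subset_Icc_self
  rw [← ofReal_integral_eq_lintegral_ofReal hint, ← integral_Ioc_eq_integral_Ioo,
    ← intervalIntegral.integral_of_le hR.le, integral_id]
  · simp
  · filter_upwards [ae_restrict_mem measurableSet_Ioo] with r hr using hr.1.le

/-- The area sub-mean value property of `|f|`. -/
lemma mul_enorm_le_lintegral_ball {f : ℂ → ℂ} {c : ℂ} {R : ℝ} (hR : 0 < R)
    (hf : DifferentiableOn ℂ f (Metric.ball c R)) :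
    ENNReal.ofReal (Real.pi * R ^ 2) * ‖f c‖ₑ ≤ ∫⁻ z in Metric.ball c R, ‖f z‖ₑ := by
  have hpi := Real.pi_pos
  have htrans : ∫⁻ z in Metric.ball c R, ‖f z‖ₑ = ∫⁻ z in Metric.ball 0 R, ‖f (c + z)‖ₑ := by
    rw [← (measurePreserving_add_left volume c).setLIntegral_comp_preimage_emb
      (measurableEmbedding_addLeft c)]
    congr 2
    ext z; simp
  have hcm : ∀ r θ, c + circleMap 0 r θ = circleMap c r θ := fun r θ => by simp [circleMap]
  rw [htrans, lintegral_ball_polar, lintegral_prod]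
  · calc ENNReal.ofReal (Real.pi * R ^ 2) * ‖f c‖ₑ
        = ∫⁻ r in Ioo 0 R, ENNReal.ofReal r * (ENNReal.ofReal (2 * Real.pi) * ‖f c‖ₑ) := by
          rw [lintegral_mul_const _ (by fun_prop), lintegral_ofReal_Ioo hR, ← mul_assoc,
            ← ENNReal.ofReal_mul (by positivity)]
          congr 2; ring
      _ ≤ _ := by
          refine setLIntegral_mono' measurableSet_Ioo fun r hr => ?_
          simp only
          rw [lintegral_const_mul' _ _ ENNReal.ofReal_ne_top]
          gcongr
          simp only [hcm]
          exact norm_le_lintegral_circle hr hf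
  · rw [Measure.prod_restrict]
    have hcont : ContinuousOn (fun x : ℝ × ℝ => f (c + circleMap 0 x.1 x.2))
        (Ioo 0 R ×ˢ Ioo (-Real.pi) Real.pi) := by
      refine hf.continuousOn.comp ?_ fun x hx => ?_
      · simp only [circleMap]; fun_prop
      · have h0 : 0 < x.1 := hx.1.1
        rw [hcm, mem_ball_iff_norm, circleMap_sub_center, norm_circleMap_zero, abs_of_pos h0]
        exact hx.1.2
    exact (by fun_prop : Measurable fun x : ℝ × ℝ => ENNReal.ofReal x.1).aemeasurable.mul
      (hcont.aemeasurable (measurableSet_Ioo.prod measurableSet_Ioo)).enorm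

/-- The area sub-mean value property of `|f|^p`. -/
lemma mul_enorm_rpow_le_lintegral_ball {p : ℝ} (hp : 1 < p) {f : ℂ → ℂ} {c : ℂ} {R : ℝ}
    (hR : 0 < R) (hf : DifferentiableOn ℂ f (Metric.ball c R)) :
    ENNReal.ofReal (Real.pi * R ^ 2) * ‖f c‖ₑ ^ p ≤ ∫⁻ z in Metric.ball c R, ‖f z‖ₑ ^ p := by
  have hpi := Real.pi_pos
  have hp0 : 0 < p := by linarith
  have hm : AEMeasurable (fun z => ‖f z‖ₑ) (volume.restrict (Metric.ball c R)) :=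
    (hf.continuousOn.aemeasurable Metric.isOpen_ball.measurableSet).enorm
  -- With `k = a = 1` the weighted Hölder inequality is Jensen's: `(∫|f|)^p ≤ V^{p-1} ∫|f|^p`, `V`
  -- being the area of the disc.
  have h := lintegral_mul_rpow_le (μ := volume.restrict (Metric.ball c R)) hp
    (k := fun _ => 1) (a := fun _ => 1) aemeasurable_const hm aemeasurable_const (by simp) (by simp)
  have hvol : volume (Metric.ball c R) = ENNReal.ofReal (Real.pi * R ^ 2) := by
    rw [Complex.volume_ball, mul_comm Real.pi, ENNReal.ofReal_mul (by positivity),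
      ENNReal.ofReal_pow hR.le, ← NNReal.coe_real_pi, ENNReal.ofReal_coe_nnreal]
  simp only [one_mul, ENNReal.one_rpow, mul_one, lintegral_one, Measure.restrict_apply_univ,
    hvol] at h
  obtain ⟨V, hV⟩ : ∃ V, V = ENNReal.ofReal (Real.pi * R ^ 2) := ⟨_, rfl⟩
  have hV0 : V ≠ 0 := by rw [hV]; simp; positivity
  have hVt : V ≠ ∞ := by rw [hV]; exact ENNReal.ofReal_ne_top
  have h1 := (ENNReal.rpow_le_rpow (mul_enorm_le_lintegral_ball hR hf) hp0.le).trans h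
  rw [← hV] at h1 ⊢
  rw [ENNReal.mul_rpow_of_nonneg _ _ hp0.le] at h1
  have e : V ^ p = V * V ^ (p - 1) := by
    conv_rhs => rw [← ENNReal.rpow_one V]
    rw [← ENNReal.rpow_mul, ← ENNReal.rpow_add _ _ hV0 hVt]; congr 1; ring
  rw [e, mul_right_comm] at h1
  refine (ENNReal.mul_le_mul_iff_left ?_ ?_).1 h1
  · simp [ENNReal.rpow_eq_zero_iff, hV0, hVt]
  · exact ENNReal.rpow_ne_top_of_nonneg (by linarith) hVt

/-- Local comparison of a regular weight with its tail on discs touching the radius. -/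
lemma IsRegular.exists_tail_le_of_mem_ball {ω : ℂ → ℝ} (hR : IsRegular ω) :
    ∃ K : ℝ, 0 < K ∧ ∀ t ∈ Ioo (0 : ℝ) 1, ∀ z ∈ Metric.ball (t : ℂ) ((1 - t) / 2),
      z ∈ disc ∧ tail ω t ≤ K * (1 - t) * ω z := by
  obtain ⟨C, hC, hCT⟩ := hR.exists_tail_le
  obtain ⟨κ, hκ, hκT⟩ := hR.exists_le_tail
  -- In the ball, `(1-t)/2 < 1 - |z| < 3(1-t)/2`. The lower bound costs `2^κ` when the tail moves
  -- outward from `t` to `|z|`; the upper one costs `3/2` in `tail ≤ C(1-|z|)ω`.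
  refine ⟨2 ^ κ * (C * (3 / 2)), by positivity, fun t ht z hz => ?_⟩
  have h1t : 0 < 1 - t := sub_pos.2 ht.2
  rw [mem_ball_iff_norm] at hz
  have hnt : ‖(t : ℂ)‖ = t := by rw [Complex.norm_real, Real.norm_eq_abs, abs_of_pos ht.1]
  have hup : ‖z‖ < t + (1 - t) / 2 := by
    have := norm_sub_norm_le z t
    rw [hnt] at this; linarith
  have hlo : t - (1 - t) / 2 < ‖z‖ := by
    have := norm_sub_norm_le (t : ℂ) z
    rw [hnt, norm_sub_rev] at this; linarith
  have hz1 : ‖z‖ ∈ Ico (0 : ℝ) 1 := ⟨norm_nonneg _, by linarith⟩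
  have hzd : z ∈ disc := by rw [disc, mem_ball_zero_iff]; exact hz1.2
  refine ⟨hzd, ?_⟩
  have h1z : 0 < 1 - ‖z‖ := sub_pos.2 hz1.2
  have hω := hR.pos_ofReal hz1
  have hT : tail ω t ≤ 2 ^ κ * tail ω ‖z‖ := by
    rcases le_or_gt ‖z‖ t with h | h
    · have h1 := hR.tail_antitoneOn hz1 ⟨ht.1.le, ht.2⟩ h
      have h2 : 1 ≤ (2 : ℝ) ^ κ := Real.one_le_rpow (by norm_num) hκ.le
      have h3 := hR.tail_pos hz1
      nlinarith
    · have h1 := hR.tail_mul_rpow_le hκT ht ⟨ht.1.trans h, hz1.2⟩ h.le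
      have h2 : (1 - t) ^ κ ≤ 2 ^ κ * (1 - ‖z‖) ^ κ := by
        rw [← Real.mul_rpow (by norm_num) h1z.le]
        exact Real.rpow_le_rpow h1t.le (by linarith) hκ.le
      have h3 := hR.tail_pos hz1
      have h4 : 0 < (1 - ‖z‖) ^ κ := by positivity
      refine le_of_mul_le_mul_right (h1.trans ?_) h4
      calc tail ω ‖z‖ * (1 - t) ^ κ ≤ tail ω ‖z‖ * (2 ^ κ * (1 - ‖z‖) ^ κ) := by gcongr
        _ = _ := by ring
  rw [hR.radial z hzd]
  calc tail ω t ≤ 2 ^ κ * tail ω ‖z‖ := hT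
    _ ≤ 2 ^ κ * (C * ((1 - ‖z‖) * ω (‖z‖ : ℝ))) := by gcongr; exact hCT _ hz1
    _ ≤ 2 ^ κ * (C * ((3 / 2 * (1 - t)) * ω (‖z‖ : ℝ))) := by gcongr; linarith
    _ = _ := by ring

/-- An overlap bound for the averaging discs. With `d = |1 - z|`, the condition forces `2d/3 < 1 - t
< 2d`: an interval of length `4d/3` on which the integrand is at most `3/(2d)`. -/
lemma lintegral_inv_one_sub_le {z : ℂ} (hz : z ∈ disc) :
    ∫⁻ t in Ioo (0 : ℝ) 1, (if ‖z - t‖ < (1 - t) / 2 then ENNReal.ofReal (1 - t)⁻¹ else 0) ≤ 2 := by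
  have hd : 0 < ‖1 - z‖ := by
    rw [norm_pos_iff, sub_ne_zero]
    rintro rfl
    simp [disc] at hz
  obtain ⟨d, hdd⟩ : ∃ d, d = ‖1 - z‖ := ⟨_, rfl⟩
  rw [← hdd] at hd
  calc _ ≤ ∫⁻ t in Ioo (0 : ℝ) 1,
        (Ioo (1 - 2 * d) (1 - 2 * d / 3)).indicator (fun _ => ENNReal.ofReal (3 / (2 * d))) t := by
        refine setLIntegral_mono' measurableSet_Ioo fun t ht => ?_
        split_ifs with h
        swap
        · exact zero_le
        have h1t : 0 < 1 - t := sub_pos.2 ht.2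
        have hn : ‖(1 : ℂ) - t‖ = 1 - t := by
          rw [← Complex.ofReal_one, ← Complex.ofReal_sub, Complex.norm_real, Real.norm_eq_abs,
            abs_of_pos h1t]
        have h1 : ‖(1 : ℂ) - t‖ ≤ ‖1 - z‖ + ‖z - t‖ := by
          simpa using norm_add_le (1 - z) (z - t)
        have h2 : ‖1 - z‖ ≤ ‖(1 : ℂ) - t‖ + ‖z - t‖ := by
          simpa using norm_sub_le ((1 : ℂ) - t) (z - t)
        rw [hn, ← hdd] at h1 h2
        rw [indicator_of_mem (mem_Ioo.2 ⟨by linarith, by linarith⟩)]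
        refine ENNReal.ofReal_le_ofReal ?_
        rw [inv_eq_one_div, div_le_div_iff₀ h1t (by positivity)]
        linarith
    _ ≤ ∫⁻ t, (Ioo (1 - 2 * d) (1 - 2 * d / 3)).indicator
          (fun _ => ENNReal.ofReal (3 / (2 * d))) t := setLIntegral_le_lintegral _ _
    _ = 2 := by
        rw [lintegral_indicator_const measurableSet_Ioo, Real.volume_Ioo,
          ← ENNReal.ofReal_mul (by positivity)]
        have : 3 / (2 * d) * (1 - 2 * d / 3 - (1 - 2 * d)) = 2 := by field_simp; ring
        rw [this]; simp

/-- The Hardy-Littlewood type inequality `∫_0^1 |f(t)|^p (∫_t^1 ω) dt ≤ C ‖f‖^p`. -/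
lemma IsRegular.exists_lintegral_radius_le {p : ℝ} (hp : 1 < p) {ω : ℂ → ℝ}
    (hR : IsRegular ω) :
    ∃ C : ℝ, ∀ f : ℂ → ℂ, AnalyticOnNhd ℂ f disc →
      ∫⁻ t in Ioo (0 : ℝ) 1, ‖f t‖ₑ ^ p * ENNReal.ofReal (tail ω t) ≤
        ENNReal.ofReal C * ∫⁻ z in disc, ‖f z‖ₑ ^ p * ENNReal.ofReal (ω z) ∂areaMeasure := by
  obtain ⟨K, hK, hKT⟩ := hR.exists_tail_le_of_mem_ball
  have hpi := Real.pi_pos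
  -- Dividing `K(1-t)` by the area `π(1-t)²/4` gives `4K/π` times `(1-t)⁻¹`; the overlap bound
  -- contributes `2`, and `1/π` is absorbed by `areaMeasure`.
  refine ⟨8 * K, fun f hf => ?_⟩
  obtain ⟨g, hg⟩ : ∃ g : ℂ → ℝ≥0∞, g = fun z => ‖f z‖ₑ ^ p * ENNReal.ofReal (ω z) := ⟨_, rfl⟩
  have hgm : AEMeasurable g (volume.restrict disc) := by
    rw [hg]
    exact ((hf.continuousOn.aemeasurable isOpen_disc.measurableSet).enorm.pow_const p).mul
      (hR.continuousOn.aemeasurable isOpen_disc.measurableSet).ennreal_ofReal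
  obtain ⟨k, hk⟩ : ∃ k : ℝ → ℂ → ℝ≥0∞, k = fun (t : ℝ) (z : ℂ) =>
    if ‖z - (t : ℂ)‖ < (1 - t) / 2 then ENNReal.ofReal (1 - t)⁻¹ else 0 := ⟨_, rfl⟩
  have hkm : Measurable (Function.uncurry k) := by
    rw [hk]
    exact Measurable.ite (measurableSet_lt (by fun_prop) (by fun_prop)) (by fun_prop)
      measurable_const
  have hpt : ∀ t ∈ Ioo (0 : ℝ) 1, ‖f t‖ₑ ^ p * ENNReal.ofReal (tail ω t) ≤
      ENNReal.ofReal (4 * K / Real.pi) * ∫⁻ z in disc, k t z * g z := by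
    intro t ht
    have h1t : 0 < 1 - t := sub_pos.2 ht.2
    have hsub : Metric.ball (t : ℂ) ((1 - t) / 2) ⊆ disc := fun z hz => (hKT t ht z hz).1
    have hsm := mul_enorm_rpow_le_lintegral_ball hp (R := (1 - t) / 2) (by positivity)
      (hf.differentiableOn.mono hsub)
    have e1 : ∫⁻ z in disc, k t z * g z =
        ENNReal.ofReal (1 - t)⁻¹ * ∫⁻ z in Metric.ball (t : ℂ) ((1 - t) / 2), g z := by
      rw [← lintegral_const_mul' _ _ ENNReal.ofReal_ne_top]
      have : (fun z => k t z * g z) = (Metric.ball (t : ℂ) ((1 - t) / 2)).indicator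
          fun z => ENNReal.ofReal (1 - t)⁻¹ * g z := by
        ext z
        simp only [hk, indicator, mem_ball_iff_norm, ite_mul, zero_mul]
      rw [this, lintegral_indicator Metric.isOpen_ball.measurableSet,
        Measure.restrict_restrict Metric.isOpen_ball.measurableSet, inter_eq_left.2 hsub]
    have e2 : (∫⁻ z in Metric.ball (t : ℂ) ((1 - t) / 2), ‖f z‖ₑ ^ p) *
        ENNReal.ofReal (tail ω t) ≤
        ENNReal.ofReal (K * (1 - t)) * ∫⁻ z in Metric.ball (t : ℂ) ((1 - t) / 2), g z := by
      rw [← lintegral_const_mul' _ _ ENNReal.ofReal_ne_top,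
        ← lintegral_mul_const' _ _ ENNReal.ofReal_ne_top]
      refine setLIntegral_mono' Metric.isOpen_ball.measurableSet fun z hz => ?_
      rw [hg]
      simp only
      rw [mul_left_comm, ← ENNReal.ofReal_mul (by positivity)]
      gcongr
      exact (hKT t ht z hz).2
    obtain ⟨V, hV⟩ : ∃ V, V = Real.pi * ((1 - t) / 2) ^ 2 := ⟨_, rfl⟩
    have hV0 : 0 < V := by rw [hV]; positivity
    rw [← hV] at hsm
    calc ‖f t‖ₑ ^ p * ENNReal.ofReal (tail ω t)
        = ENNReal.ofReal V⁻¹ * (ENNReal.ofReal V * ‖f t‖ₑ ^ p * ENNReal.ofReal (tail ω t)) := by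
          rw [← mul_assoc, ← mul_assoc, ← ENNReal.ofReal_mul (by positivity),
            inv_mul_cancel₀ hV0.ne', ENNReal.ofReal_one, one_mul]
      _ ≤ ENNReal.ofReal V⁻¹ * (ENNReal.ofReal (K * (1 - t)) *
            ∫⁻ z in Metric.ball (t : ℂ) ((1 - t) / 2), g z) := by
          exact mul_le_mul' le_rfl ((mul_le_mul' hsm le_rfl).trans e2)
      _ = _ := by
          rw [e1, ← mul_assoc, ← mul_assoc, ← ENNReal.ofReal_mul (by positivity),
            ← ENNReal.ofReal_mul (by positivity)]
          congr 2
          rw [hV]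
          field_simp
          norm_num
  calc ∫⁻ t in Ioo (0 : ℝ) 1, ‖f t‖ₑ ^ p * ENNReal.ofReal (tail ω t)
      ≤ ∫⁻ t in Ioo (0 : ℝ) 1, ENNReal.ofReal (4 * K / Real.pi) * ∫⁻ z in disc, k t z * g z :=
        setLIntegral_mono' measurableSet_Ioo hpt
    _ = ENNReal.ofReal (4 * K / Real.pi) *
          ∫⁻ t in Ioo (0 : ℝ) 1, ∫⁻ z in disc, k t z * g z :=
        lintegral_const_mul' _ _ ENNReal.ofReal_ne_top
    _ = ENNReal.ofReal (4 * K / Real.pi) *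
          ∫⁻ z in disc, ∫⁻ t in Ioo (0 : ℝ) 1, k t z * g z := by
        rw [lintegral_lintegral_swap]
        exact hkm.aemeasurable.mul hgm.comp_snd
    _ ≤ ENNReal.ofReal (4 * K / Real.pi) * ∫⁻ z in disc, 2 * g z := by
        refine mul_le_mul' le_rfl ?_
        refine setLIntegral_mono' isOpen_disc.measurableSet fun z hz => ?_
        have hkz : Measurable fun t => k t z := hkm.comp measurable_prodMk_right
        rw [lintegral_mul_const _ hkz]
        gcongr
        rw [hk]
        exact lintegral_inv_one_sub_le hz
    _ = _ := by
        rw [lintegral_areaMeasure_disc, lintegral_const_mul' _ _ (by norm_num), ← mul_assoc,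
          ← mul_assoc, ← ENNReal.ofReal_mul (by positivity), hg]
        congr 1
        rw [← ENNReal.ofReal_ofNat, ← ENNReal.ofReal_mul (by positivity)]
        congr 1
        field_simp
        norm_num

/-! ### The Cauchy-type transform on the Bergman space -/

lemma norm_ofReal_mul_lt_one {t : ℝ} (ht : t ∈ Ioo (0 : ℝ) 1) {z : ℂ} (hz : z ∈ disc) :
    ‖(t : ℂ) * z‖ < 1 := by
  rw [disc, mem_ball_zero_iff] at hz
  rw [norm_mul, Complex.norm_real, Real.norm_eq_abs, abs_of_pos ht.1]
  nlinarith [ht.1, ht.2, norm_nonneg z]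

/-- Both `1 - t` and `|(1-t)z|` are at most `|1 - tz|`, and `1 - z = (1 - tz) - (1-t)z`. -/
lemma add_norm_le_norm_one_sub {t : ℝ} (ht : t ∈ Ioo (0 : ℝ) 1) {z : ℂ} (hz : z ∈ disc) :
    1 - t + ‖1 - z‖ ≤ 3 * ‖1 - t * z‖ := by
  rw [disc, mem_ball_zero_iff] at hz
  have hnt : ‖(t : ℂ) * z‖ = t * ‖z‖ := by
    rw [norm_mul, Complex.norm_real, Real.norm_eq_abs, abs_of_pos ht.1]
  have h1 : 1 - t ≤ ‖1 - t * z‖ := by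
    have := norm_sub_norm_le (1 : ℂ) (t * z)
    rw [norm_one, hnt] at this
    nlinarith [ht.1, norm_nonneg z]
  have h2 : ‖1 - z‖ ≤ ‖1 - t * z‖ + ‖((1 - t : ℝ) : ℂ) * z‖ := by
    have := norm_sub_le (1 - t * z) (((1 - t : ℝ) : ℂ) * z)
    have e : 1 - z = 1 - t * z - ((1 - t : ℝ) : ℂ) * z := by push_cast; ring
    rwa [e]
  have h3 : ‖((1 - t : ℝ) : ℂ) * z‖ ≤ 1 - t := by
    rw [norm_mul, Complex.norm_real, Real.norm_eq_abs, abs_of_pos (sub_pos.2 ht.2)]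
    nlinarith [ht.2, norm_nonneg z]
  linarith

lemma one_sub_le_norm_one_sub_mul {t : ℝ} (ht : t ∈ Ioo (0 : ℝ) 1) {z : ℂ} {ρ : ℝ} (hz : ‖z‖ ≤ ρ) :
    1 - ρ ≤ ‖1 - t * z‖ := by
  have := norm_sub_norm_le (1 : ℂ) (t * z)
  rw [norm_one, norm_mul, Complex.norm_real, Real.norm_eq_abs, abs_of_pos ht.1] at this
  nlinarith [ht.1, ht.2, norm_nonneg z]

/-- The transform `∫_0^1 ψ(t) / (1 - tz) dt`. -/
noncomputable def cauchyTransform (ψ : ℝ → ℂ) (z : ℂ) : ℂ :=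
  ∫ t in Ioo (0 : ℝ) 1, ψ t / (1 - t * z)

lemma integrableOn_div_one_sub {ψ : ℝ → ℂ} (hψ : IntegrableOn ψ (Ioo 0 1)) {z : ℂ}
    (hz : z ∈ disc) : IntegrableOn (fun t : ℝ => ψ t / (1 - t * z)) (Ioo 0 1) := by
  have hz1 : ‖z‖ < 1 := by rwa [disc, mem_ball_zero_iff] at hz
  simp only [div_eq_mul_inv]
  refine Integrable.mul_bdd (c := (1 - ‖z‖)⁻¹) hψ
    (Measurable.aestronglyMeasurable (by fun_prop)) ?_
  filter_upwards [ae_restrict_mem measurableSet_Ioo] with t ht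
  rw [norm_inv]
  exact inv_anti₀ (sub_pos.2 hz1) (one_sub_le_norm_one_sub_mul ht le_rfl)

lemma analyticOnNhd_cauchyTransform {ψ : ℝ → ℂ} (hψ : IntegrableOn ψ (Ioo 0 1)) :
    AnalyticOnNhd ℂ (cauchyTransform ψ) disc := by
  refine DifferentiableOn.analyticOnNhd (fun z hz => ?_) isOpen_disc
  have hz1 : ‖z‖ < 1 := by rwa [disc, mem_ball_zero_iff] at hz
  -- On the ball of radius `ρ < 1` the denominators stay at least `1 - ρ`, giving one integrable
  -- majorant for differentiation under the integral.
  obtain ⟨ρ, hzρ, hρ1⟩ := exists_between hz1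
  have hs : Metric.ball (0 : ℂ) ρ ∈ nhds z :=
    Metric.isOpen_ball.mem_nhds (by rwa [mem_ball_zero_iff])
  have hρ : 0 < 1 - ρ := sub_pos.2 hρ1
  refine (hasDerivAt_integral_of_dominated_loc_of_deriv_le (𝕜 := ℂ)
    (μ := volume.restrict (Ioo (0 : ℝ) 1)) (F := fun z t => ψ t / (1 - t * z))
    (F' := fun z t => ψ t * (t / (1 - t * z) ^ 2))
    (bound := fun t => ‖ψ t‖ * ((1 - ρ) ^ 2)⁻¹) hs ?_ (integrableOn_div_one_sub hψ hz) ?_ ?_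
    (hψ.norm.mul_const _) ?_).2.differentiableAt.differentiableWithinAt
  · refine Filter.Eventually.of_forall fun x => ?_
    simp only [div_eq_mul_inv]
    exact hψ.aestronglyMeasurable.mul (Measurable.aestronglyMeasurable (by fun_prop))
  · exact hψ.aestronglyMeasurable.mul (Measurable.aestronglyMeasurable (by fun_prop))
  · filter_upwards [ae_restrict_mem measurableSet_Ioo] with t ht x hx
    rw [mem_ball_zero_iff] at hx
    rw [norm_mul, norm_div, norm_pow, Complex.norm_real, Real.norm_eq_abs, abs_of_pos ht.1]
    gcongr
    rw [inv_eq_one_div]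
    gcongr
    · exact ht.2.le
    · exact one_sub_le_norm_one_sub_mul ht hx.le
  · filter_upwards [ae_restrict_mem measurableSet_Ioo] with t ht x hx
    rw [mem_ball_zero_iff] at hx
    have hne : (1 : ℂ) - t * x ≠ 0 := by
      rw [← norm_pos_iff]
      exact hρ.trans_le (one_sub_le_norm_one_sub_mul ht hx.le)
    have hd : HasDerivAt (fun x : ℂ => 1 - t * x) (-(t : ℂ)) x := by
      simpa using ((hasDerivAt_id x).const_mul (t : ℂ)).const_sub 1
    simp only [div_eq_mul_inv]
    refine ((hd.inv hne).const_mul (ψ t)).congr_deriv ?_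
    simp [div_eq_mul_inv]

lemma enorm_cauchyTransform_le (ψ : ℝ → ℂ) {z : ℂ} (hz : z ∈ disc) :
    ‖cauchyTransform ψ z‖ₑ ≤ 3 * stieltjes (fun t => ‖ψ t‖ₑ) ‖1 - z‖ := by
  rw [stieltjes, ← lintegral_const_mul' _ _ (by norm_num)]
  refine (enorm_integral_le_lintegral_enorm _).trans ?_
  refine setLIntegral_mono' measurableSet_Ioo fun t ht => ?_
  have h1t : 0 < 1 - t := sub_pos.2 ht.2
  have h0 : 0 < 1 - t + ‖1 - z‖ := by positivity
  have h := add_norm_le_norm_one_sub ht hz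
  have hpos : 0 < ‖1 - t * z‖ := by linarith
  rw [div_eq_mul_inv, enorm_mul, mul_left_comm]
  gcongr
  rw [← ofReal_norm, norm_inv, ← ENNReal.ofReal_ofNat, ← ENNReal.ofReal_mul (by norm_num)]
  refine ENNReal.ofReal_le_ofReal ?_
  rw [inv_eq_one_div, ← div_eq_mul_inv, div_le_div_iff₀ hpos h0]
  linarith

/-- The kernel is at least `1/2` on the unit square, so if `∫ φ = ∞` the Stieltjes transform is
identically infinite there, and so is its weighted norm. -/
lemma setLIntegral_ne_top_of_stieltjes {p : ℝ} (hp : 0 < p) {T : ℝ → ℝ}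
    (hT : ∀ r ∈ Ioo (0 : ℝ) 1, 0 < T r) {φ : ℝ → ℝ≥0∞}
    (h : ∫⁻ r in Ioo (0 : ℝ) 1, ENNReal.ofReal (T r) * stieltjes φ (1 - r) ^ p ≠ ∞) :
    ∫⁻ t in Ioo (0 : ℝ) 1, φ t ≠ ∞ := by
  intro htop
  refine h ?_
  have : ∀ r ∈ Ioo (0 : ℝ) 1, ENNReal.ofReal (T r) * stieltjes φ (1 - r) ^ p = ∞ := by
    intro r hr
    have hs : stieltjes φ (1 - r) = ∞ := by
      refine top_unique ?_
      calc (∞ : ℝ≥0∞) = (∫⁻ t in Ioo (0 : ℝ) 1, φ t) * ENNReal.ofReal (1 / 2) := by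
            rw [htop, ENNReal.top_mul (by simp)]
        _ = ∫⁻ t in Ioo (0 : ℝ) 1, φ t * ENNReal.ofReal (1 / 2) :=
            (lintegral_mul_const' _ _ ENNReal.ofReal_ne_top).symm
        _ ≤ _ := by
            refine setLIntegral_mono' measurableSet_Ioo fun t ht => ?_
            gcongr
            rw [inv_eq_one_div]
            gcongr
            · linarith [ht.2, hr.2]
            · linarith [ht.1, hr.1]
    rw [hs, ENNReal.top_rpow_of_pos hp, ENNReal.mul_top (by simpa using hT r hr)]
  rw [setLIntegral_congr_fun measurableSet_Ioo this]
  simp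

/-- Boundedness of the transform of any function dominated by `|f|` on the radius. -/
lemma exists_cauchyTransform_bound {p : ℝ} (hp : 1 < p) {ω : ℂ → ℝ} (hR : IsRegular ω)
    (hM : IsMuckenhoupt p ω) :
    ∃ C : ℝ≥0, ∀ f : ℂ → ℂ, MemBergman p ω f → ∀ ψ : ℝ → ℂ,
      AEStronglyMeasurable ψ (volume.restrict (Ioo 0 1)) →
      (∀ t ∈ Ioo (0 : ℝ) 1, ‖ψ t‖ₑ = ‖f t‖ₑ) →
      IntegrableOn ψ (Ioo 0 1) ∧ MemBergman p ω (cauchyTransform ψ) ∧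
        bergmanNorm p ω (cauchyTransform ψ) ≤ C * bergmanNorm p ω f := by
  have hp0 : 0 < p := by linarith
  obtain ⟨C₁, h₁⟩ := hR.exists_lintegral_disc_le
  obtain ⟨C₂, h₂⟩ := exists_stieltjes_le hp hR hM
  obtain ⟨C₃, h₃⟩ := hR.exists_lintegral_radius_le hp
  obtain ⟨K, hK⟩ : ∃ K : ℝ≥0∞, K = 3 ^ p * ENNReal.ofReal C₁ * ENNReal.ofReal C₂ *
    ENNReal.ofReal C₃ := ⟨_, rfl⟩
  have h3t : (3 : ℝ≥0∞) ^ p ≠ ∞ := ENNReal.rpow_ne_top_of_nonneg hp0.le (by norm_num)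
  have hKt : K ≠ ∞ := by
    rw [hK]
    exact ENNReal.mul_ne_top (ENNReal.mul_ne_top (ENNReal.mul_ne_top h3t ENNReal.ofReal_ne_top)
      ENNReal.ofReal_ne_top) ENNReal.ofReal_ne_top
  refine ⟨(K ^ (1 / p)).toNNReal, fun f hf ψ hψm hψ => ?_⟩
  obtain ⟨I, hI⟩ : ∃ I, I = ∫⁻ z in disc, ‖f z‖ₑ ^ p * ENNReal.ofReal (ω z) ∂areaMeasure :=
    ⟨_, rfl⟩
  have hnorm : bergmanNorm p ω f = I ^ (1 / p) := by rw [hI, bergmanNorm]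
  have hIt : I ≠ ∞ := by
    have := hf.norm_lt_top
    rw [hnorm] at this
    intro h
    rw [h, ENNReal.top_rpow_of_pos (by positivity)] at this
    exact lt_irrefl _ this
  have hrad : ∫⁻ t in Ioo (0 : ℝ) 1, ‖ψ t‖ₑ ^ p * ENNReal.ofReal (tail ω t) ≤
      ENNReal.ofReal C₃ * I := by
    rw [hI]
    refine le_of_eq_of_le (setLIntegral_congr_fun measurableSet_Ioo fun t ht => ?_)
      (h₃ f hf.analytic)
    simp only [hψ t ht]
  have hst : ∫⁻ r in Ioo (0 : ℝ) 1, ENNReal.ofReal (tail ω r) *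
      stieltjes (fun t => ‖ψ t‖ₑ) (1 - r) ^ p ≤
      ENNReal.ofReal C₂ * (ENNReal.ofReal C₃ * I) :=
    (h₂ _ hψm.enorm).trans (by gcongr)
  -- Only after the Stieltjes bound is `ψ` known to be integrable, which convergence and analyticity
  -- of the transform rest on.
  have hψi : IntegrableOn ψ (Ioo 0 1) := by
    refine ⟨hψm, lt_top_iff_ne_top.2 (setLIntegral_ne_top_of_stieltjes hp0
      (fun r hr => hR.tail_pos ⟨hr.1.le, hr.2⟩) (ne_top_of_le_ne_top ?_ hst))⟩
    exact ENNReal.mul_ne_top ENNReal.ofReal_ne_top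
      (ENNReal.mul_ne_top ENNReal.ofReal_ne_top hIt)
  have hmain : ∫⁻ z in disc, ‖cauchyTransform ψ z‖ₑ ^ p * ENNReal.ofReal (ω z) ∂areaMeasure ≤
      K * I := by
    calc _ ≤ ∫⁻ z in disc, 3 ^ p * (stieltjes (fun t => ‖ψ t‖ₑ) ‖1 - z‖ ^ p *
          ENNReal.ofReal (ω z)) ∂areaMeasure := by
          refine setLIntegral_mono' isOpen_disc.measurableSet fun z hz => ?_
          rw [← mul_assoc, ← ENNReal.mul_rpow_of_nonneg _ _ hp0.le]
          gcongr
          exact enorm_cauchyTransform_le ψ hz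
      _ = 3 ^ p * ∫⁻ z in disc, stieltjes (fun t => ‖ψ t‖ₑ) ‖1 - z‖ ^ p *
          ENNReal.ofReal (ω z) ∂areaMeasure := lintegral_const_mul' _ _ h3t
      _ ≤ 3 ^ p * (ENNReal.ofReal C₁ * (ENNReal.ofReal C₂ * (ENNReal.ofReal C₃ * I))) := by
          gcongr
          refine (h₁ (fun s => stieltjes (fun t => ‖ψ t‖ₑ) s ^ p) ?_).trans (by gcongr)
          intro s hs s' hs' hss
          exact ENNReal.rpow_le_rpow (stieltjes_antitoneOn _ hs hs' hss) hp0.le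
      _ = K * I := by rw [hK]; ring
  have hbound : bergmanNorm p ω (cauchyTransform ψ) ≤ K ^ (1 / p) * bergmanNorm p ω f := by
    rw [hnorm, ← ENNReal.mul_rpow_of_nonneg _ _ (by positivity)]
    exact ENNReal.rpow_le_rpow hmain (by positivity)
  have hKp : K ^ (1 / p) ≠ ∞ := ENNReal.rpow_ne_top_of_nonneg (by positivity) hKt
  refine ⟨hψi, ⟨analyticOnNhd_cauchyTransform hψi, ?_⟩, ?_⟩
  · exact hbound.trans_lt (ENNReal.mul_lt_top hKp.lt_top hf.norm_lt_top)
  · rwa [ENNReal.coe_toNNReal hKp]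

/-! ### Identification of the Hilbert operators -/

/-- For `|z| < 1` the real part of `1 - z` is positive, so `1/(1-z)` avoids the cut of the principal
logarithm. -/
lemma deriv_logSymbol {z : ℂ} (hz : ‖z‖ < 1) : deriv logSymbol z = 1 / (1 - z) := by
  have hre : 0 < (1 - z).re := by
    have := (Complex.abs_re_le_norm z).trans_lt hz
    rw [Complex.sub_re, Complex.one_re]
    linarith [(abs_lt.1 this).2]
  have hne : 1 - z ≠ 0 := by
    intro h
    rw [h] at hre
    simp at hre
  have hslit : (1 : ℂ) / (1 - z) ∈ Complex.slitPlane := by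
    rw [one_div, Complex.slitPlane, mem_ofPred_eq]
    left
    rw [Complex.inv_re]
    exact div_pos hre (Complex.normSq_pos.2 hne)
  have hd : HasDerivAt (fun z : ℂ => 1 - z) (-1) z := by
    simpa using (hasDerivAt_id z).const_sub 1
  have h2 : HasDerivAt (fun z : ℂ => 1 / (1 - z)) (1 / (1 - z) ^ 2) z := by
    simp only [one_div]
    exact (hd.inv hne).congr_deriv (by simp)
  have h3 : HasDerivAt logSymbol (1 / (1 - z) ^ 2 / (1 / (1 - z))) z := h2.clog hslit
  rw [h3.deriv]
  field_simp

lemma genHilbertIntegrand_logSymbol (f : ℂ → ℂ) {z : ℂ} (hz : z ∈ disc) {t : ℝ}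
    (ht : t ∈ Ioo (0 : ℝ) 1) :
    genHilbertIntegrand logSymbol f z t = f t / (1 - t * z) := by
  rw [genHilbertIntegrand, deriv_logSymbol (norm_ofReal_mul_lt_one ht hz), mul_one_div]

lemma hilbert_eq (f : ℂ → ℂ) {z : ℂ} (hz : z ∈ disc) :
    hilbert f z = cauchyTransform (fun t => f t) z :=
  setIntegral_congr_fun measurableSet_Ioo fun _ ht => genHilbertIntegrand_logSymbol f hz ht

lemma bergmanNorm_congr {p : ℝ} {ω : ℂ → ℝ} {f g : ℂ → ℂ} (h : ∀ z ∈ disc, f z = g z) :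
    bergmanNorm p ω f = bergmanNorm p ω g := by
  rw [bergmanNorm, bergmanNorm, setLIntegral_congr_fun isOpen_disc.measurableSet]
  intro z hz
  simp only [h z hz]

lemma MemBergman.congr {p : ℝ} {ω : ℂ → ℝ} {f g : ℂ → ℂ} (hg : MemBergman p ω g)
    (h : ∀ z ∈ disc, f z = g z) : MemBergman p ω f where
  analytic := hg.analytic.congr isOpen_disc fun z hz => (h z hz).symm
  norm_lt_top := bergmanNorm_congr h ▸ hg.norm_lt_top

end HilbertBergman

theorem corollary3 (p : ℝ) (hp : 1 < p) (ω : ℂ → ℝ)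
    (hR : HilbertBergman.IsRegular ω) (hM : HilbertBergman.IsMuckenhoupt p ω) :
    -- both operators are well defined: the defining integrals converge absolutely
    (∀ f : ℂ → ℂ, HilbertBergman.MemBergman p ω f → ∀ z ∈ HilbertBergman.disc,
      IntegrableOn (HilbertBergman.genHilbertIntegrand HilbertBergman.logSymbol f z)
          (Ioo (0 : ℝ) 1) ∧
        IntegrableOn (HilbertBergman.subHilbertIntegrand f z) (Ioo (0 : ℝ) 1)) ∧
    -- the Hilbert operator is bounded
    HilbertBergman.IsBoundedOnBergman p ω HilbertBergman.hilbert ∧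
    -- the sublinear Hilbert operator is bounded
    HilbertBergman.IsBoundedOnBergman p ω HilbertBergman.subHilbert := by
  obtain ⟨C, hC⟩ := HilbertBergman.exists_cauchyTransform_bound hp hR hM
  have hfm : ∀ f : ℂ → ℂ, HilbertBergman.MemBergman p ω f →
      AEStronglyMeasurable (fun t : ℝ => f t) (volume.restrict (Ioo 0 1)) := fun f hf =>
    ((HilbertBergman.continuousOn_ofReal_disc hf.analytic.continuousOn).mono
      Ioo_subset_Ico_self).aestronglyMeasurable measurableSet_Ioo
  have hH := fun f hf => hC f hf (fun t => f t) (hfm f hf) fun _ _ => rfl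
  -- Taking `ψ = |f|` makes `subHilbert f` the Cauchy transform by definition, so no congruence on
  -- the disc is needed, unlike for `hilbert`.
  have hS := fun f hf => hC f hf (fun t => ((‖f t‖ : ℝ) : ℂ))
    (Complex.continuous_ofReal.comp_aestronglyMeasurable (hfm f hf).norm) fun t _ => by
      rw [← ofReal_norm, Complex.norm_real, norm_norm, ofReal_norm]
  refine ⟨fun f hf z hz => ⟨?_, HilbertBergman.integrableOn_div_one_sub (hS f hf).1 hz⟩,
    ⟨C, fun f hf => ⟨(hH f hf).2.1.congr fun z hz => HilbertBergman.hilbert_eq f hz, ?_⟩⟩,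
    ⟨C, fun f hf => (hS f hf).2⟩⟩
  · exact (HilbertBergman.integrableOn_div_one_sub (hH f hf).1 hz).congr_fun
      (fun t ht => (HilbertBergman.genHilbertIntegrand_logSymbol f hz ht).symm) measurableSet_Ioo
  · rw [HilbertBergman.bergmanNorm_congr fun z hz => HilbertBergman.hilbert_eq f hz]
    exact (hH f hf).2.2
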